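/- **Corollary 7.1 (Characterization of Besicovitch almost periodic measures).** Let $G$ be a $\sigma$-compact locally compact (Hausdorff) abelian group with Haar measure $|\cdot|$ and dual group $\widehat G$ (the continuous homomorphisms $G\to\{z\in\mathbb C:|z|=1\}$). Let $\mathcal A=(A_n)$ be a van Hove sequence in $G$: the $A_n$ are non-empty, open and relatively compact, and $|\partial^K A_n|/|A_n|\to 0$ for every compact $K\subseteq G$, where $\partial^K A=(\overline{A+K}\setminus A)\cup(((G\setminus A)-K)\cap\overline A)$. Let $\mu$ be a translation bounded (complex) Radon measure on $G$, i.e. a linear functional on $C_c(G)$, continuous for the inductive topology, for which $\mu*\varphi(t)=\int_G\varphi(t-s)\,d\mu(s)$ is a bounded function of $t\in G$ for each $\varphi\in C_c(G)$. Let $G$ act on Radon measures by translations, $\int\varphi\,d(t.\nu)=\int\varphi(s-t)\,d\nu(s)$, so that $((t.\nu)*\varphi)(s)=(\nu*\varphi)(s+t)$, and let the hull $\mathbb X(\mu)$ be the closure of $\{t.\mu:t\in G\}$ in the vague topology (the topology of convergence on each $\varphi\in C_c(G)$), equipped with its Borel $\sigma$-algebra. Then the following are equivalent. 1. $\mu$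 is Besicovitch almost periodic along $\mathcal A$: for every $\varphi\in C_c(G)$ and $\varepsilon>0$ there is a finite linear combination $p$ of elements of $\widehat G$ with $$\limsup_{n\to\infty}\Big(\frac1{|A_n|}\int_{A_n}|(\mu*\varphi)(t)-p(t)|^2\,dt\Big)^{1/2}\le\varepsilon .$$ 2. There is a regular Borel probability measure $m$ on $\mathbb X(\mu)$, invariant and ergodic under $G$, such that $(\mathbb X(\mu),G,m)$ has pure point spectrum and $\mu$ is a Wiener--Wintner point for $(m,\mathcal A)$. Here $0\ne f\in L^2(\mathbb X(\mu),m)$ is an eigenfunction to $\chi\in\widehat G$ if, for every $t\in G$, $f(t.x)=\chi(t)f(x)$ for $m$-almost every $x$; the eigenspace to $\chi$ consists of these $f$ and $0$; $\chi$ is an eigenvalue if it has an eigenfunction. Pure point spectrum means that the linear span of all eigenfunctions is dense in $L^2(\mathbb X(\mu),m)$. A point $x$ is a Wiener--Wintner point for $(m,\mathcal A)$ if there is a set $B$ of eigenfunctions such that, for every eigenvalue $\chi$, the members of $B$ which are eigenfunctions to $\chi$ form an orthonormal basis of the eigenspace to $\chi$, and such that, for all continuous $f:\mathbb X(\mu)\to\mathbb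 C$ and all $e\in B$, with eigenvalue $\chi_e$, $$\lim_{n\to\infty}\frac1{|A_n|}\int_{A_n}f(t.x)\,\overline{\chi_e(t)}\,dt=\int_{\mathbb X(\mu)}f\,\overline e\,dm .$$ -/

import Mathlib

open MeasureTheory Filter Topology CompactlySupported
open scoped ENNReal Pointwise

noncomputable section

namespace WienerWintner

/-! ### Characters, van Hove sequences, Besicovitch almost periodic functions -/

/-- The dual group of an additive topological group `G`: continuous homomorphisms
from `G` to the unit circle. -/
abbrev Dual (G : Type*) [AddCommGroup G] [TopologicalSpace G] : Type _ :=
  PontryaginDual (Multiplicative G)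

/-- A character as a complex valued function on `G`. -/
def charValue {G : Type*} [AddCommGroup G] [TopologicalSpace G] (χ : Dual G) (t : G) : ℂ :=
  ((χ (Multiplicative.ofAdd t) : Circle) : ℂ)

/-- The van Hove boundary `∂^K A = (closure (A + K) \ A) ∪ ((Aᶜ - K) ∩ closure A)`. -/
def vanHoveBoundary {G : Type*} [AddCommGroup G] [TopologicalSpace G] (K A : Set G) : Set G :=
  (closure (A + K) \ A) ∪ ((Aᶜ - K) ∩ closure A)

/-- `A` is a van Hove sequence with respect to the Haar measure `θ`: a sequence of non-empty
relatively compact open sets with `|∂^K A_n| / |A_n| → 0` for every compact `K`. -/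
structure IsVanHove {G : Type*} [AddCommGroup G] [TopologicalSpace G] [MeasurableSpace G]
    (θ : Measure G) (A : ℕ → Set G) : Prop where
  isOpen : ∀ n, IsOpen (A n)
  nonempty : ∀ n, (A n).Nonempty
  isCompact_closure : ∀ n, IsCompact (closure (A n))
  tendsto_boundary : ∀ K : Set G, IsCompact K →
    Tendsto (fun n => θ (vanHoveBoundary K (A n)) / θ (A n)) atTop (𝓝 0)

/-- Trigonometric polynomials: linear combinations of characters. -/
def trigPoly (G : Type*) [AddCommGroup G] [TopologicalSpace G] : Submodule ℂ (G → ℂ) :=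
  Submodule.span ℂ (Set.range (charValue : Dual G → G → ℂ))

/-- The Besicovitch seminorm
`limsup_n (|A_n|⁻¹ ∫_{A_n} |h(t)|² dt)^{1/2}`, with values in `[0, ∞]`. -/
def besicovitchSeminorm {G : Type*} [MeasurableSpace G] (θ : Measure G) (A : ℕ → Set G)
    (h : G → ℂ) : ℝ≥0∞ :=
  limsup (fun n => ((θ (A n))⁻¹ * ∫⁻ t in A n, ‖h t‖ₑ ^ 2 ∂θ) ^ (1 / 2 : ℝ)) atTop

/-- Besicovitch almost periodic functions with respect to `A`: bounded measurable functions
which can be approximated by trigonometric polynomials in the Besicovitch seminorm. -/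
structure IsBesicovitchAP {G : Type*} [AddCommGroup G] [TopologicalSpace G] [MeasurableSpace G]
    (θ : Measure G) (A : ℕ → Set G) (h : G → ℂ) : Prop where
  measurable : Measurable h
  bounded : ∃ M : ℝ, ∀ t, ‖h t‖ ≤ M
  approx : ∀ ε : ℝ, 0 < ε → ∃ p ∈ trigPoly G,
    besicovitchSeminorm θ A (h - p) ≤ ENNReal.ofReal ε

/-! ### Radon measures, the vague topology, translation bounded measures, the hull -/

/-- A complex Radon measure on `G`: a linear functional on `C_c(G)` that is continuous for the
inductive limit topology, i.e. bounded in supremum norm on the functions supported in any given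
compact set. -/
structure RadonMeasure (G : Type*) [TopologicalSpace G] where
  toLinearMap : C_c(G, ℂ) →ₗ[ℂ] ℂ
  bounded_of_isCompact : ∀ K : Set G, IsCompact K → ∃ C : ℝ, ∀ φ : C_c(G, ℂ), tsupport φ ⊆ K →
    ∀ M : ℝ, (∀ s, ‖φ s‖ ≤ M) → ‖toLinearMap φ‖ ≤ C * M

section Translates

variable {G : Type*} [AddCommGroup G] [TopologicalSpace G] [IsTopologicalAddGroup G]

/-- The translate `s ↦ φ (s - t)` of `φ ∈ C_c(G)`. -/
def translateFun (t : G) (φ : C_c(G, ℂ)) : C_c(G, ℂ) where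
  toFun s := φ (s - t)
  continuous_toFun := φ.continuous.comp (continuous_id.sub continuous_const)
  hasCompactSupport' := φ.hasCompactSupport.comp_homeomorph (Homeomorph.subRight t)

/-- The reflected translate `s ↦ φ (t - s)` of `φ ∈ C_c(G)`. -/
def reflectFun (t : G) (φ : C_c(G, ℂ)) : C_c(G, ℂ) where
  toFun s := φ (t - s)
  continuous_toFun := φ.continuous.comp (continuous_const.sub continuous_id)
  hasCompactSupport' := φ.hasCompactSupport.comp_homeomorph (Homeomorph.subLeft t)

end Translates

namespace RadonMeasure

variable {G : Type*} [TopologicalSpace G]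

/-- The vague topology: convergence on test functions from `C_c(G)`. -/
instance : TopologicalSpace (RadonMeasure G) :=
  TopologicalSpace.induced (fun (μ : RadonMeasure G) (φ : C_c(G, ℂ)) => μ.toLinearMap φ)
    inferInstance

instance : MeasurableSpace (RadonMeasure G) := borel _

instance : BorelSpace (RadonMeasure G) := ⟨rfl⟩

@[ext]
theorem ext {μ ν : RadonMeasure G} (h : ∀ φ, μ.toLinearMap φ = ν.toLinearMap φ) : μ = ν := by
  cases μ
  cases ν
  congr 1
  exact LinearMap.ext h

variable [AddCommGroup G] [IsTopologicalAddGroup G]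

/-- The convolution `(μ * φ)(t) = ∫ φ(t - s) dμ(s)`. -/
def conv (μ : RadonMeasure G) (φ : C_c(G, ℂ)) (t : G) : ℂ :=
  μ.toLinearMap (reflectFun t φ)

/-- `μ` is translation bounded: `μ * φ` is a bounded function for all `φ ∈ C_c(G)`. -/
def TranslationBounded (μ : RadonMeasure G) : Prop :=
  ∀ φ : C_c(G, ℂ), ∃ M : ℝ, ∀ t, ‖μ.conv φ t‖ ≤ M

/-- A measure is Besicovitch almost periodic along `A` if all `μ * φ`, `φ ∈ C_c(G)`, are. -/
def IsBesicovitchAP [MeasurableSpace G] (θ : Measure G) (A : ℕ → Set G)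
    (μ : RadonMeasure G) : Prop :=
  ∀ φ : C_c(G, ℂ), WienerWintner.IsBesicovitchAP θ A (μ.conv φ)

/-- The translate `t.μ`, given by `∫ φ d(t.μ) = ∫ φ(s - t) dμ(s)`. The sign is the one for which
coding along orbits is convolution: `((t.μ) * φ)(s) = (μ * φ)(s + t)`. -/
def translate (t : G) (μ : RadonMeasure G) : RadonMeasure G where
  toLinearMap :=
    { toFun := fun φ => μ.toLinearMap (translateFun t φ)
      map_add' := fun φ ψ => by
        rw [← map_add]
        rfl
      map_smul' := fun c φ => by
        rw [RingHom.id_apply, ← map_smul]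
        rfl }
  bounded_of_isCompact := fun K hK => by
    obtain ⟨C, hC⟩ := μ.bounded_of_isCompact ((fun s => s - t) ⁻¹' K)
      ((Homeomorph.subRight t).isCompact_preimage.mpr hK)
    refine ⟨C, fun φ hφ M hM => hC (translateFun t φ) ?_ M fun s => hM (s - t)⟩
    have h : tsupport (translateFun t φ) = (Homeomorph.subRight t) ⁻¹' tsupport φ :=
      tsupport_comp_eq_preimage φ (Homeomorph.subRight t)
    rw [h]
    exact fun s hs => hφ hs

instance : AddAction G (RadonMeasure G) where
  vadd := translate
  zero_vadd μ := by
    ext φ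
    change μ.toLinearMap (translateFun 0 φ) = _
    congr 1
    ext s
    change φ (s - 0) = φ s
    rw [sub_zero]
  add_vadd t u μ := by
    ext φ
    change μ.toLinearMap (translateFun (t + u) φ) = μ.toLinearMap (translateFun u (translateFun t φ))
    congr 1
    ext s
    change φ (s - (t + u)) = φ (s - u - t)
    congr 1
    abel

theorem vadd_apply (t : G) (μ : RadonMeasure G) (φ : C_c(G, ℂ)) :
    (t +ᵥ μ).toLinearMap φ = μ.toLinearMap (translateFun t φ) := rfl

theorem continuous_const_vadd (t : G) : Continuous fun μ : RadonMeasure G => t +ᵥ μ := by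
  refine continuous_induced_rng.mpr (continuous_pi fun φ => ?_)
  exact (continuous_apply (translateFun t φ)).comp continuous_induced_dom

/-- The hull of `μ`: the vague closure of the orbit of `μ`. (For translation bounded `μ` all
elements of the closure are again translation bounded.) -/
def hull (μ : RadonMeasure G) : Set (RadonMeasure G) :=
  closure (Set.range fun t : G => t +ᵥ μ)

theorem self_mem_hull (μ : RadonMeasure G) : μ ∈ hull μ :=
  subset_closure ⟨0, zero_vadd G μ⟩

theorem vadd_mem_hull (μ : RadonMeasure G) (t : G) {ν : RadonMeasure G} (hν : ν ∈ hull μ) :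
    t +ᵥ ν ∈ hull μ := by
  refine map_mem_closure (continuous_const_vadd t) hν ?_
  rintro _ ⟨u, rfl⟩
  exact ⟨t + u, add_vadd t u μ⟩

/-- The group `G` acts on the hull by translations. -/
instance (μ : RadonMeasure G) : AddAction G (hull μ) where
  vadd t ν := ⟨t +ᵥ ν.1, vadd_mem_hull μ t ν.2⟩
  zero_vadd ν := Subtype.ext (zero_vadd G ν.1)
  add_vadd t u ν := Subtype.ext (add_vadd t u ν.1)

/-- The measure `μ` as a point of its hull. -/
def toHull (μ : RadonMeasure G) : hull μ := ⟨μ, self_mem_hull μ⟩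

end RadonMeasure

/-! ### Eigenfunctions and Wiener-Wintner points of a system `(X, G, m)` -/

section Dynamics

variable {G X : Type*} [AddCommGroup G] [TopologicalSpace G] [MeasurableSpace X] [AddAction G X]

/-- `f ∈ L²(X, m)` is an eigenfunction to the eigenvalue `χ`: it is non-zero and
`f(t.x) = χ(t) f(x)` for almost every `x`, for all `t`. -/
def IsEigenfunction (m : Measure X) (χ : Dual G) (f : Lp ℂ 2 m) : Prop :=
  f ≠ 0 ∧ ∀ t : G, (fun x => f (t +ᵥ x)) =ᵐ[m] fun x => charValue χ t * f x

/-- The eigenspace to `χ`: all eigenfunctions to `χ` together with `0`. -/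
def eigenspace (m : Measure X) (χ : Dual G) : Set (Lp ℂ 2 m) :=
  {f | f = 0 ∨ IsEigenfunction m χ f}

/-- The point spectrum: the set of eigenvalues. -/
def pointSpectrum (G : Type*) [AddCommGroup G] [TopologicalSpace G] [AddAction G X]
    (m : Measure X) : Set (Dual G) :=
  {χ | ∃ f, IsEigenfunction m χ f}

/-- `(X, G, m)` has pure point spectrum: the linear span of the eigenfunctions is dense
in `L²(X, m)`. -/
def HasPurePointSpectrum (G : Type*) [AddCommGroup G] [TopologicalSpace G] [AddAction G X]
    (m : Measure X) : Prop :=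
  (Submodule.span ℂ {f : Lp ℂ 2 m | ∃ χ : Dual G, IsEigenfunction m χ f}).topologicalClosure = ⊤

/-- `x` is a Wiener-Wintner point of `(X, G, m)` with respect to `A`: there is a set `B` of
eigenfunctions containing, for each eigenvalue `χ`, an orthonormal basis of the eigenspace, such
that `|A_n|⁻¹ ∫_{A_n} f(t.x) conj(χ_e(t)) dt → ⟨f, e⟩` for all `f ∈ C(X)` and all `e ∈ B` with
eigenvalue `χ_e`. -/
def IsWienerWintnerPoint [TopologicalSpace X] [MeasurableSpace G] (θ : Measure G)
    (A : ℕ → Set G) (m : Measure X) (x : X) : Prop :=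
  ∃ B : Set (Lp ℂ 2 m),
    (∀ e ∈ B, ∃ χ : Dual G, IsEigenfunction m χ e) ∧
    (∀ χ ∈ pointSpectrum G m,
      Orthonormal ℂ (Subtype.val : {e : Lp ℂ 2 m // e ∈ B ∧ IsEigenfunction m χ e} → Lp ℂ 2 m) ∧
      ((Submodule.span ℂ {e : Lp ℂ 2 m | e ∈ B ∧ IsEigenfunction m χ e}).topologicalClosure :
        Set (Lp ℂ 2 m)) = eigenspace m χ) ∧
    (∀ f : C(X, ℂ), ∀ e ∈ B, ∀ χ : Dual G, IsEigenfunction m χ e →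
      Tendsto
        (fun n => ((θ.real (A n) : ℂ))⁻¹ *
          ∫ t in A n, f (t +ᵥ x) * (starRingEnd ℂ) (charValue χ t) ∂θ)
        atTop (𝓝 (∫ y, f y * (starRingEnd ℂ) (e y) ∂m)))

end Dynamics

end WienerWintner

end

/-! Let `ν n` be Haar measure normalised on `A n`. Translation boundedness makes the hull compact,
and the evaluations at test functions, read along the orbit of `μ`, are the convolutions of `μ`.
These evaluations separate the points of the hull, and the functions approximable by trigonometric
polynomials in quadratic mean along `ν` form a star algebra closed under uniform limits. By
Stone–Weierstrass, `μ` is Besicovitch almost periodic iff `t ↦ f (t +ᵥ μ)` is approximable for every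
continuous `f` on the hull (`isBesicovitchAP_iff_approximable`). What remains concerns a compact
system and one point with continuous orbit map.

If all orbit functions are approximable, the Fourier coefficients `a_χ(f)`, the limits of the
averages of `f (t +ᵥ x₀) * conj (χ t)`, exist. The functional `a_1` is positive and normalised, so
it is integration against an invariant `m`. Each `a_χ` is bounded by the `L²(m)` norm, hence `a_χ(f)
= ⟪e χ, f⟫` with `‖e χ‖ ≤ 1`, and translation covariance makes `e χ` zero or an eigenfunction.
Approximability turns into Parseval's identity for `f` and the `e χ`. Holding on a dense set, it
forces every non-zero `e χ` to have norm one and the family to span a dense subspace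
(`exists_eigenfunctions_of_approximable`). Pure point spectrum, one-dimensional eigenspaces,
ergodicity and the Wiener–Wintner limits follow.

Conversely, the Wiener–Wintner limits determine the members of `B`, so there is exactly one for each
eigenvalue. The eigenvalue `1` shows that the orbit averages converge to `m`, and Parseval for `B`
says that finite Fourier sums approximate `f` in mean square along the orbit
(`approximable_of_tendsto_inner`). -/

set_option linter.unusedSectionVars false

noncomputable section

namespace WienerWintner

/-! ### Bessel and Parseval for orthogonal families that may contain zero -/

section Hilbert

variable {H ι : Type*} [NormedAddCommGroup H] [InnerProductSpace ℂ H]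

open scoped InnerProductSpace

/-- Only `‖e i‖ ≤ 1` is assumed because the family will be indexed by all characters, and those that
are not eigenvalues contribute the zero vector. The bound enters through the norm of the projection
sum; the cross term is exact. -/
theorem norm_sub_sum_inner_smul_sq_le {e : ι → H}
    (horth : Pairwise fun i j => ⟪e i, e j⟫_ℂ = 0) (hle : ∀ i, ‖e i‖ ≤ 1) (S : Finset ι) (f : H) :
    ‖f - ∑ i ∈ S, ⟪e i, f⟫_ℂ • e i‖ ^ 2 ≤ ‖f‖ ^ 2 - ∑ i ∈ S, ‖⟪e i, f⟫_ℂ‖ ^ 2 := by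
  classical
  set g := ∑ i ∈ S, ⟪e i, f⟫_ℂ • e i with hg
  have h1 : ⟪f, g⟫_ℂ = ((∑ i ∈ S, ‖⟪e i, f⟫_ℂ‖ ^ 2 : ℝ) : ℂ) := by
    rw [hg, inner_sum, Complex.ofReal_sum]
    refine Finset.sum_congr rfl fun i _ => ?_
    rw [inner_smul_right, ← inner_conj_symm f (e i), Complex.mul_conj, Complex.normSq_eq_norm_sq]
  have h2 : ‖g‖ ^ 2 ≤ ∑ i ∈ S, ‖⟪e i, f⟫_ℂ‖ ^ 2 := by
    have h3 : ⟪g, g⟫_ℂ = ((∑ i ∈ S, ‖⟪e i, f⟫_ℂ‖ ^ 2 * ‖e i‖ ^ 2 : ℝ) : ℂ) := by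
      conv_lhs => rw [hg]
      rw [sum_inner, Complex.ofReal_sum]
      refine Finset.sum_congr rfl fun i hi => ?_
      rw [inner_sum, Finset.sum_eq_single i]
      · rw [inner_smul_left, inner_smul_right, inner_self_eq_norm_sq_to_K, ← mul_assoc, mul_comm
          ((starRingEnd ℂ) _), Complex.mul_conj, Complex.normSq_eq_norm_sq]
        push_cast
        rfl
      · intro j _ hj
        rw [inner_smul_left, inner_smul_right, horth hj.symm]
        simp
      · exact fun h => absurd hi h
    have h4 : ‖g‖ ^ 2 = ∑ i ∈ S, ‖⟪e i, f⟫_ℂ‖ ^ 2 * ‖e i‖ ^ 2 := by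
      rw [inner_self_eq_norm_sq_to_K] at h3
      exact Complex.ofReal_injective (by simpa using h3)
    rw [h4]
    refine Finset.sum_le_sum fun i _ => mul_le_of_le_one_right (by positivity) ?_
    exact pow_le_one₀ (norm_nonneg _) (hle i)
  have h5 := @norm_sub_sq ℂ H _ _ _ f g
  rw [h1] at h5
  rw [h5]
  simp only [RCLike.re_to_complex, Complex.ofReal_re]
  linarith

theorem sum_norm_inner_sq_le {e : ι → H}
    (horth : Pairwise fun i j => ⟪e i, e j⟫_ℂ = 0) (hle : ∀ i, ‖e i‖ ≤ 1) (S : Finset ι) (f : H) :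
    ∑ i ∈ S, ‖⟪e i, f⟫_ℂ‖ ^ 2 ≤ ‖f‖ ^ 2 := by
  linarith [norm_sub_sum_inner_smul_sq_le horth hle S f,
    sq_nonneg ‖f - ∑ i ∈ S, ⟪e i, f⟫_ℂ • e i‖]

theorem span_range_topologicalClosure_eq_top {e : ι → H}
    (horth : Pairwise fun i j => ⟪e i, e j⟫_ℂ = 0) (hle : ∀ i, ‖e i‖ ≤ 1) {D : Set H}
    (hD : Dense D) (hP : ∀ f ∈ D, ∀ ε : ℝ, 0 < ε →
      ∃ S : Finset ι, ‖f‖ ^ 2 ≤ ∑ i ∈ S, ‖⟪e i, f⟫_ℂ‖ ^ 2 + ε) :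
    (Submodule.span ℂ (Set.range e)).topologicalClosure = ⊤ := by
  have hsub : D ⊆ ((Submodule.span ℂ (Set.range e)).topologicalClosure : Set H) := by
    intro f hf
    rw [Submodule.topologicalClosure_coe, Metric.mem_closure_iff]
    intro ε hε
    obtain ⟨S, hS⟩ := hP f hf ((ε / 2) ^ 2) (by positivity)
    refine ⟨∑ i ∈ S, ⟪e i, f⟫_ℂ • e i, Submodule.sum_mem _ fun i _ =>
      Submodule.smul_mem _ _ (Submodule.subset_span ⟨i, rfl⟩), ?_⟩
    rw [dist_eq_norm]
    have h := norm_sub_sum_inner_smul_sq_le horth hle S f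
    have : ‖f - ∑ i ∈ S, ⟪e i, f⟫_ℂ • e i‖ ≤ ε / 2 :=
      (pow_le_pow_iff_left₀ (norm_nonneg _) (by positivity) two_ne_zero).mp (by linarith)
    linarith
  rw [← SetLike.coe_set_eq, Submodule.top_coe, Set.eq_univ_iff_forall]
  intro f
  exact closure_minimal hsub (Submodule.isClosed_topologicalClosure _) (hD f)

/-- For `f ∈ D`, the coefficients of `f` with index `j ≠ i` are those of `f - e i`, so Bessel bounds
them by `‖f - e i‖ ^ 2`. The resulting inequality is closed in `f`, hence holds at `f = e i`, where
it reads `‖e i‖ ^ 2 ≤ ‖e i‖ ^ 4`. -/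
theorem norm_eq_one_of_parseval {e : ι → H}
    (horth : Pairwise fun i j => ⟪e i, e j⟫_ℂ = 0) (hle : ∀ i, ‖e i‖ ≤ 1) {D : Set H}
    (hD : Dense D) (hP : ∀ f ∈ D, ∀ ε : ℝ, 0 < ε →
      ∃ S : Finset ι, ‖f‖ ^ 2 ≤ ∑ i ∈ S, ‖⟪e i, f⟫_ℂ‖ ^ 2 + ε) (i : ι) (hi : e i ≠ 0) :
    ‖e i‖ = 1 := by
  classical
  have hsub : D ⊆ {f : H | ‖f‖ ^ 2 ≤ ‖⟪e i, f⟫_ℂ‖ ^ 2 + ‖f - e i‖ ^ 2} := by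
    intro f hf
    rw [Set.mem_ofPred_eq]
    refine le_of_forall_pos_le_add fun ε hε => ?_
    obtain ⟨S, hS⟩ := hP f hf ε hε
    have h1 : ∑ j ∈ S, ‖⟪e j, f⟫_ℂ‖ ^ 2 ≤
        ‖⟪e i, f⟫_ℂ‖ ^ 2 + ∑ j ∈ S.erase i, ‖⟪e j, f⟫_ℂ‖ ^ 2 := by
      rw [← Finset.sum_insert (f := fun j => ‖⟪e j, f⟫_ℂ‖ ^ 2) (Finset.notMem_erase i S)]
      exact Finset.sum_le_sum_of_subset_of_nonneg (Finset.subset_insert_iff.mpr subset_rfl)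
        fun _ _ _ => by positivity
    have h2 : ∑ j ∈ S.erase i, ‖⟪e j, f⟫_ℂ‖ ^ 2 = ∑ j ∈ S.erase i, ‖⟪e j, f - e i⟫_ℂ‖ ^ 2 := by
      refine Finset.sum_congr rfl fun j hj => ?_
      rw [inner_sub_right, horth (Finset.ne_of_mem_erase hj), sub_zero]
    have h3 := sum_norm_inner_sq_le horth hle (S.erase i) (f - e i)
    linarith
  have hcl : IsClosed {f : H | ‖f‖ ^ 2 ≤ ‖⟪e i, f⟫_ℂ‖ ^ 2 + ‖f - e i‖ ^ 2} :=
    isClosed_le (by fun_prop) (by fun_prop)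
  have h := closure_minimal hsub hcl (hD (e i))
  simp only [Set.mem_ofPred_eq, sub_self, norm_zero] at h
  rw [inner_self_eq_norm_sq_to_K] at h
  have hpos : 0 < ‖e i‖ ^ 2 := by positivity
  have h' : ‖e i‖ ^ 2 * 1 ≤ ‖e i‖ ^ 2 * ‖e i‖ ^ 2 := by
    simp only [Complex.coe_algebraMap, norm_pow, Complex.norm_real, norm_norm] at h
    nlinarith
  have h1 := le_of_mul_le_mul_left h' hpos
  refine le_antisymm (hle i) ?_
  exact (pow_le_pow_iff_left₀ zero_le_one (norm_nonneg _) two_ne_zero).mp (by linarith)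

end Hilbert

/-! ### Characters and the star algebra of trigonometric polynomials -/

section Characters

variable {G : Type*} [AddCommGroup G] [TopologicalSpace G]

theorem charValue_add (χ : Dual G) (s t : G) :
    charValue χ (s + t) = charValue χ s * charValue χ t := by
  simp [charValue, ofAdd_add]

@[simp] theorem charValue_one (t : G) : charValue (1 : Dual G) t = 1 := rfl

@[simp] theorem charValue_mul (χ ψ : Dual G) (t : G) :
    charValue (χ * ψ) t = charValue χ t * charValue ψ t := rfl

theorem charValue_inv (χ : Dual G) (t : G) :
    charValue χ⁻¹ t = (starRingEnd ℂ) (charValue χ t) :=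
  Circle.coe_inv_eq_conj _

@[simp] theorem norm_charValue (χ : Dual G) (t : G) : ‖charValue χ t‖ = 1 :=
  Circle.norm_coe _

theorem charValue_mul_conj (χ : Dual G) (t : G) :
    charValue χ t * (starRingEnd ℂ) (charValue χ t) = 1 := by
  rw [Complex.mul_conj, Complex.normSq_eq_norm_sq, norm_charValue]
  simp

theorem charValue_injective : Function.Injective (charValue : Dual G → G → ℂ) := by
  intro χ ψ h
  ext t
  exact congrFun h (Multiplicative.toAdd t)

theorem continuous_charValue (χ : Dual G) : Continuous (charValue χ) :=
  continuous_subtype_val.comp ((map_continuous χ).comp continuous_ofAdd)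

open BoundedContinuousFunction

/-- A character as a bounded continuous function. -/
def charBCF (χ : Dual G) : G →ᵇ ℂ :=
  .ofNormedAddCommGroup (charValue χ) (continuous_charValue χ) 1 fun t => (norm_charValue χ t).le

@[simp] theorem charBCF_apply (χ : Dual G) (t : G) : charBCF χ t = charValue χ t := rfl

/-- Trigonometric polynomials as bounded continuous functions. -/
def trigBCF (G : Type*) [AddCommGroup G] [TopologicalSpace G] : Submodule ℂ (G →ᵇ ℂ) :=
  Submodule.span ℂ (Set.range charBCF)

theorem charBCF_mem_trigBCF (χ : Dual G) : charBCF χ ∈ trigBCF G :=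
  Submodule.subset_span ⟨χ, rfl⟩

theorem mul_mem_trigBCF {p q : G →ᵇ ℂ} (hp : p ∈ trigBCF G) (hq : q ∈ trigBCF G) :
    p * q ∈ trigBCF G := by
  have h := Submodule.mul_mem_mul hp hq
  rw [trigBCF, Submodule.span_mul_span] at h
  refine Submodule.span_mono ?_ h
  rintro _ ⟨_, ⟨χ, rfl⟩, _, ⟨ψ, rfl⟩, rfl⟩
  exact ⟨χ * ψ, by ext t; simp⟩

theorem star_mem_trigBCF {p : G →ᵇ ℂ} (hp : p ∈ trigBCF G) : star p ∈ trigBCF G := by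
  induction hp using Submodule.span_induction with
  | mem x h =>
    obtain ⟨χ, rfl⟩ := h
    refine Submodule.subset_span ⟨χ⁻¹, ?_⟩
    ext t
    simp [charValue_inv]
  | zero => rw [star_zero]; exact Submodule.zero_mem _
  | add x y _ _ hx hy => rw [star_add]; exact Submodule.add_mem _ hx hy
  | smul c x _ hx => rw [star_smul]; exact Submodule.smul_mem _ _ hx

theorem mem_trigPoly_iff {p : G → ℂ} : p ∈ trigPoly G ↔ ∃ q ∈ trigBCF G, ⇑q = p := by
  let L : (G →ᵇ ℂ) →ₗ[ℂ] (G → ℂ) :=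
    { toFun := fun q => ⇑q, map_add' := fun _ _ => rfl, map_smul' := fun _ _ => rfl }
  have h : trigPoly G = (trigBCF G).map L := by
    rw [trigPoly, trigBCF, Submodule.map_span, ← Set.range_comp]
    rfl
  rw [h]
  rfl

end Characters

/-! ### Approximability in quadratic mean and existence of means -/

section Averages

open BoundedContinuousFunction

variable {G : Type*} [AddCommGroup G] [TopologicalSpace G] [MeasurableSpace G] [BorelSpace G]

/-- Functions approximable by trigonometric polynomials in quadratic mean along `ν`. -/
def Approximable (ν : ℕ → Measure G) (h : G →ᵇ ℂ) : Prop :=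
  ∀ ε : ℝ, 0 < ε → ∃ p ∈ trigBCF G, ∀ᶠ n in atTop, ∫ t, ‖(h - p) t‖ ^ 2 ∂ν n ≤ ε

theorem integrable_norm_sq (ρ : Measure G) [IsFiniteMeasure ρ] (h : G →ᵇ ℂ) :
    Integrable (fun t => ‖h t‖ ^ 2) ρ := by
  refine Integrable.of_bound (C := ‖h‖ ^ 2) ?_ (ae_of_all _ fun t => ?_)
  · exact (h.continuous.norm.pow 2).aestronglyMeasurable
  · rw [norm_pow, norm_norm]
    exact pow_le_pow_left₀ (norm_nonneg _) (h.norm_coe_le_norm t) 2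

theorem integral_norm_add_sq_le (ρ : Measure G) [IsFiniteMeasure ρ] (h k : G →ᵇ ℂ) :
    ∫ t, ‖(h + k) t‖ ^ 2 ∂ρ ≤ 2 * ∫ t, ‖h t‖ ^ 2 ∂ρ + 2 * ∫ t, ‖k t‖ ^ 2 ∂ρ := by
  rw [← integral_const_mul, ← integral_const_mul, ← integral_add
    ((integrable_norm_sq ρ h).const_mul _) ((integrable_norm_sq ρ k).const_mul _)]
  refine integral_mono (integrable_norm_sq ρ _)
    (((integrable_norm_sq ρ h).const_mul _).add ((integrable_norm_sq ρ k).const_mul _)) fun t => ?_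
  have h1 := norm_add_le (h t) (k t)
  have h2 : ‖(h + k) t‖ ^ 2 ≤ (‖h t‖ + ‖k t‖) ^ 2 := pow_le_pow_left₀ (norm_nonneg _) h1 2
  simp only
  nlinarith [sq_nonneg (‖h t‖ - ‖k t‖)]

theorem integral_norm_mul_sq_le (ρ : Measure G) [IsFiniteMeasure ρ] (h k : G →ᵇ ℂ) :
    ∫ t, ‖(h * k) t‖ ^ 2 ∂ρ ≤ ‖h‖ ^ 2 * ∫ t, ‖k t‖ ^ 2 ∂ρ := by
  rw [← integral_const_mul]
  refine integral_mono (integrable_norm_sq ρ _) ((integrable_norm_sq ρ k).const_mul _) fun t => ?_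
  simp only [BoundedContinuousFunction.mul_apply, norm_mul, mul_pow]
  gcongr
  exact h.norm_coe_le_norm t

/-- Cauchy–Schwarz, obtained by integrating the pointwise inequality `‖h‖ ≤ δ / 2 + ‖h‖ ^ 2 / (2 *
δ)`. -/
theorem norm_integral_le_of_sq_le (ρ : Measure G) [IsProbabilityMeasure ρ] (h : G →ᵇ ℂ) {δ : ℝ}
    (hδ : 0 < δ) (H : ∫ t, ‖h t‖ ^ 2 ∂ρ ≤ δ ^ 2) : ‖∫ t, h t ∂ρ‖ ≤ δ := by
  have h1 : ∫ t, ‖h t‖ ∂ρ ≤ ∫ t, (δ / 2 + (2 * δ)⁻¹ * ‖h t‖ ^ 2) ∂ρ := by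
    refine integral_mono (h.integrable ρ).norm
      ((integrable_const _).add ((integrable_norm_sq ρ h).const_mul _)) fun t => ?_
    have : δ / 2 + (2 * δ)⁻¹ * ‖h t‖ ^ 2 - ‖h t‖ = (2 * δ)⁻¹ * (δ - ‖h t‖) ^ 2 := by
      field_simp
      ring
    have h3 : 0 ≤ (2 * δ)⁻¹ * (δ - ‖h t‖) ^ 2 := by positivity
    simp only
    linarith
  rw [integral_add (integrable_const _) ((integrable_norm_sq ρ h).const_mul _),
    integral_const_mul] at h1
  simp only [integral_const, probReal_univ, smul_eq_mul, one_mul] at h1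
  refine (norm_integral_le_integral_norm _).trans (h1.trans ?_)
  have : (2 * δ)⁻¹ * ∫ t, ‖h t‖ ^ 2 ∂ρ ≤ (2 * δ)⁻¹ * δ ^ 2 := by gcongr
  have h4 : (2 * δ)⁻¹ * δ ^ 2 = δ / 2 := by field_simp
  linarith

variable {ν : ℕ → Measure G} [∀ n, IsProbabilityMeasure (ν n)]

theorem approximable_of_mem_trigBCF {p : G →ᵇ ℂ} (hp : p ∈ trigBCF G) : Approximable ν p :=
  fun ε hε => ⟨p, hp, by simp [hε.le]⟩

theorem Approximable.add {h k : G →ᵇ ℂ} (hh : Approximable ν h) (hk : Approximable ν k) :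
    Approximable ν (h + k) := by
  intro ε hε
  obtain ⟨p, hp, hp'⟩ := hh (ε / 4) (by positivity)
  obtain ⟨q, hq, hq'⟩ := hk (ε / 4) (by positivity)
  refine ⟨p + q, Submodule.add_mem _ hp hq, ?_⟩
  filter_upwards [hp', hq'] with n h1 h2
  have h3 := integral_norm_add_sq_le (ν n) (h - p) (k - q)
  rw [add_sub_add_comm]
  linarith

theorem Approximable.mul {h k : G →ᵇ ℂ} (hh : Approximable ν h) (hk : Approximable ν k) :
    Approximable ν (h * k) := by
  intro ε hε
  -- In `h * k - p * q = h * (k - q) + q * (h - p)` the second term carries the sup norm of `q`, so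
  -- `q` is fixed before `p`.
  obtain ⟨q, hq, hq'⟩ := hk (ε / (4 * (‖h‖ ^ 2 + 1))) (by positivity)
  obtain ⟨p, hp, hp'⟩ := hh (ε / (4 * (‖q‖ ^ 2 + 1))) (by positivity)
  refine ⟨p * q, mul_mem_trigBCF hp hq, ?_⟩
  filter_upwards [hp', hq'] with n h1 h2
  have h3 := integral_norm_add_sq_le (ν n) (h * (k - q)) (q * (h - p))
  have h4 := integral_norm_mul_sq_le (ν n) h (k - q)
  have h5 := integral_norm_mul_sq_le (ν n) q (h - p)
  have key : ∀ a x : ℝ, x ≤ ε / (4 * (a ^ 2 + 1)) → a ^ 2 * x ≤ ε / 4 := fun a x hx => by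
    have : a ^ 2 * x ≤ (a ^ 2) * (ε / (4 * (a ^ 2 + 1))) := by gcongr
    refine this.trans ?_
    rw [mul_div_assoc', div_le_div_iff₀ (by positivity) (by positivity)]
    nlinarith
  have h6 := key _ _ h2
  have h7 := key _ _ h1
  rw [show h * k - p * q = h * (k - q) + q * (h - p) by ring]
  linarith

theorem Approximable.star {h : G →ᵇ ℂ} (hh : Approximable ν h) : Approximable ν (star h) := by
  intro ε hε
  obtain ⟨p, hp, hp'⟩ := hh ε hε
  refine ⟨_, star_mem_trigBCF hp, ?_⟩
  rw [← star_sub]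
  refine hp'.mono fun n hn => ?_
  simp only [BoundedContinuousFunction.star_apply, norm_star]
  exact hn

theorem Approximable.of_forall_norm_sub_le {h : G →ᵇ ℂ}
    (H : ∀ ε : ℝ, 0 < ε → ∃ k, Approximable ν k ∧ ‖h - k‖ ≤ ε) : Approximable ν h := by
  intro ε hε
  obtain ⟨k, hk, hhk⟩ := H (√(ε / 4)) (by positivity)
  obtain ⟨p, hp, hp'⟩ := hk (ε / 4) (by positivity)
  refine ⟨p, hp, ?_⟩
  filter_upwards [hp'] with n hn
  have h3 := integral_norm_add_sq_le (ν n) (h - k) (k - p)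
  have h4 : ∫ t, ‖(h - k) t‖ ^ 2 ∂ν n ≤ ε / 4 := by
    have : ∫ t, ‖(h - k) t‖ ^ 2 ∂ν n ≤ ∫ t, ε / 4 ∂ν n := by
      refine integral_mono (integrable_norm_sq _ _) (integrable_const _) fun t => ?_
      have h5 := ((h - k).norm_coe_le_norm t).trans hhk
      calc ‖(h - k) t‖ ^ 2 ≤ √(ε / 4) ^ 2 := pow_le_pow_left₀ (norm_nonneg _) h5 2
        _ = ε / 4 := Real.sq_sqrt (by positivity)
    simpa using this
  rw [sub_add_sub_cancel] at h3
  linarith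

/-- The translate `t ↦ h (t + s)` of a bounded continuous function. -/
def shiftBCF [ContinuousAdd G] (s : G) (h : G →ᵇ ℂ) : G →ᵇ ℂ :=
  h.compContinuous ⟨fun t => t + s, continuous_id.add continuous_const⟩

@[simp] theorem shiftBCF_apply [ContinuousAdd G] (s : G) (h : G →ᵇ ℂ) (t : G) :
    shiftBCF s h t = h (t + s) := rfl

/-- Averages along `ν` are asymptotically invariant under translations. -/
def AsymptoticallyInvariant [ContinuousAdd G] (ν : ℕ → Measure G) : Prop :=
  ∀ (s : G) (h : G →ᵇ ℂ), Tendsto (fun n => ∫ t, shiftBCF s h t ∂ν n - ∫ t, h t ∂ν n) atTop (𝓝 0)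

/-- The mean value of a bounded continuous function along `ν` (meaningful if the limit exists). -/
def mean (ν : ℕ → Measure G) (h : G →ᵇ ℂ) : ℂ :=
  limUnder atTop fun n => ∫ t, h t ∂ν n

/-- Translation by `s` multiplies the average by `χ s`, yet changes it by a null sequence; take `s`
with `χ s ≠ 1`. -/
theorem tendsto_charBCF [ContinuousAdd G] (hν : AsymptoticallyInvariant ν) {χ : Dual G}
    (hχ : χ ≠ 1) : Tendsto (fun n => ∫ t, charBCF χ t ∂ν n) atTop (𝓝 0) := by
  obtain ⟨s, hs⟩ : ∃ s, charValue χ s ≠ 1 := by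
    by_contra! h
    exact hχ (charValue_injective (funext fun t => by simp [h]))
  have h1 := (hν s (charBCF χ)).const_mul (charValue χ s - 1)⁻¹
  rw [mul_zero] at h1
  refine h1.congr fun n => ?_
  have h2 : ∫ t, shiftBCF s (charBCF χ) t ∂ν n = charValue χ s * ∫ t, charBCF χ t ∂ν n := by
    rw [← integral_const_mul]
    simp [charValue_add, mul_comm]
  have h3 := sub_ne_zero.mpr hs
  rw [h2]
  field_simp

theorem exists_tendsto_of_mem_trigBCF [ContinuousAdd G] (hν : AsymptoticallyInvariant ν)
    {p : G →ᵇ ℂ} (hp : p ∈ trigBCF G) :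
    ∃ c, Tendsto (fun n => ∫ t, p t ∂ν n) atTop (𝓝 c) := by
  induction hp using Submodule.span_induction with
  | mem x h =>
    obtain ⟨χ, rfl⟩ := h
    by_cases hχ : χ = 1
    · refine ⟨1, ?_⟩
      simp [hχ]
    · exact ⟨0, tendsto_charBCF hν hχ⟩
  | zero => exact ⟨0, by simp⟩
  | add x y _ _ hx hy =>
    obtain ⟨c, hc⟩ := hx
    obtain ⟨d, hd⟩ := hy
    refine ⟨c + d, (hc.add hd).congr fun n => ?_⟩
    exact (integral_add (x.integrable _) (y.integrable _)).symm
  | smul c x _ hx =>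
    obtain ⟨d, hd⟩ := hx
    refine ⟨c * d, (hd.const_mul c).congr fun n => ?_⟩
    exact (integral_const_mul _ _).symm

theorem tendsto_mean [ContinuousAdd G] (hν : AsymptoticallyInvariant ν)
    {h : G →ᵇ ℂ} (hh : Approximable ν h) :
    Tendsto (fun n => ∫ t, h t ∂ν n) atTop (𝓝 (mean ν h)) := by
  refine tendsto_nhds_limUnder (cauchySeq_tendsto_of_complete (Metric.cauchySeq_iff'.mpr
    fun ε hε => ?_))
  obtain ⟨p, hp, hp'⟩ := hh ((ε / 4) ^ 2) (by positivity)
  obtain ⟨c, hc⟩ := exists_tendsto_of_mem_trigBCF hν hp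
  obtain ⟨N, hN⟩ := Metric.cauchySeq_iff.mp hc.cauchySeq (ε / 4) (by positivity)
  obtain ⟨M, hM⟩ := eventually_atTop.mp hp'
  have key : ∀ n ≥ M, dist (∫ t, h t ∂ν n) (∫ t, p t ∂ν n) ≤ ε / 4 := fun n hn => by
    rw [dist_eq_norm, ← integral_sub (h.integrable _) (p.integrable _)]
    exact norm_integral_le_of_sq_le (ν n) (h - p) (by positivity) (hM n hn)
  refine ⟨max M N, fun n hn => ?_⟩
  have h1 := key n (le_of_max_le_left hn)
  have h2 := key (max M N) (le_max_left _ _)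
  have h3 := hN n (le_of_max_le_right hn) (max M N) (le_max_right _ _)
  have h4 := dist_triangle4 (∫ t, h t ∂ν n) (∫ t, p t ∂ν n) (∫ t, p t ∂ν (max M N))
    (∫ t, h t ∂ν (max M N))
  rw [dist_comm (∫ t, p t ∂ν (max M N)) (∫ t, h t ∂ν (max M N))] at h4
  linarith

end Averages

/-! ### Mean-square distance to a trigonometric polynomial -/

section Averages

open BoundedContinuousFunction

variable {G : Type*} [AddCommGroup G] [TopologicalSpace G] [ContinuousAdd G] [MeasurableSpace G]
  [BorelSpace G] {ν : ℕ → Measure G} [∀ n, IsProbabilityMeasure (ν n)]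

theorem norm_sub_smul_charBCF_sq (F : G →ᵇ ℂ) (χ : Dual G) (c : ℂ) (t : G) :
    ‖(F - c • charBCF χ) t‖ ^ 2 =
      ‖F t‖ ^ 2 - 2 * ((starRingEnd ℂ) c * (F * star (charBCF χ)) t).re + ‖c‖ ^ 2 := by
  have h1 : ‖charValue χ t‖ ^ 2 = 1 := by simp
  simp only [BoundedContinuousFunction.sub_apply, BoundedContinuousFunction.smul_apply,
    charBCF_apply, smul_eq_mul, BoundedContinuousFunction.mul_apply,
    BoundedContinuousFunction.star_apply, ← Complex.normSq_eq_norm_sq, RCLike.star_def]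
  rw [Complex.normSq_sub, map_mul Complex.normSq, Complex.normSq_eq_norm_sq (charValue χ t), h1,
    mul_one, map_mul]
  have : F t * ((starRingEnd ℂ) c * (starRingEnd ℂ) (charValue χ t)) =
    (starRingEnd ℂ) c * (F t * (starRingEnd ℂ) (charValue χ t)) := by ring
  rw [this]
  ring

/-- Expanding the square gives `V - 2 * re (conj c * a) + ‖c‖ ^ 2`; completing it isolates the error
of `c` against the Fourier coefficient `a`. -/
theorem tendsto_integral_norm_sub_smul_charBCF_sq {F : G →ᵇ ℂ} {V : ℝ}
    (hV : Tendsto (fun n => ∫ t, ‖F t‖ ^ 2 ∂ν n) atTop (𝓝 V)) {χ : Dual G} {a : ℂ}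
    (ha : Tendsto (fun n => ∫ t, (F * star (charBCF χ)) t ∂ν n) atTop (𝓝 a)) (c : ℂ) :
    Tendsto (fun n => ∫ t, ‖(F - c • charBCF χ) t‖ ^ 2 ∂ν n) atTop
      (𝓝 (V + (‖c - a‖ ^ 2 - ‖a‖ ^ 2))) := by
  have h1 : V + (‖c - a‖ ^ 2 - ‖a‖ ^ 2) = V - 2 * ((starRingEnd ℂ) c * a).re + ‖c‖ ^ 2 := by
    rw [← Complex.normSq_eq_norm_sq (c - a), Complex.normSq_sub, Complex.normSq_eq_norm_sq,
      Complex.normSq_eq_norm_sq]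
    simp only [Complex.mul_re, Complex.conj_re, Complex.conj_im]
    ring
  rw [h1]
  have h2 := (Complex.continuous_re.tendsto _).comp (ha.const_mul ((starRingEnd ℂ) c))
  refine ((hV.sub (h2.const_mul 2)).add_const (‖c‖ ^ 2)).congr fun n => ?_
  simp only [norm_sub_smul_charBCF_sq, Function.comp]
  have hi := ((F * star (charBCF χ)).integrable (ν n)).const_mul ((starRingEnd ℂ) c)
  have hre : ∫ t, ((starRingEnd ℂ) c * (F * star (charBCF χ)) t).re ∂ν n =
      ((starRingEnd ℂ) c * ∫ t, (F * star (charBCF χ)) t ∂ν n).re := by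
    rw [← integral_const_mul]
    exact integral_re hi
  have hi2 : Integrable (fun t => 2 * ((starRingEnd ℂ) c * (F * star (charBCF χ)) t).re) (ν n) :=
    hi.re.const_mul 2
  have hi3 : Integrable (fun t => ‖F t‖ ^ 2 -
      2 * ((starRingEnd ℂ) c * (F * star (charBCF χ)) t).re) (ν n) :=
    (integrable_norm_sq _ F).sub hi2
  rw [integral_add hi3 (integrable_const _), integral_sub (integrable_norm_sq _ F) hi2,
    integral_const_mul, hre]
  simp

theorem tendsto_integral_norm_sub_sum_sq (hν : AsymptoticallyInvariant ν) (a c : Dual G → ℂ)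
    (S : Finset (Dual G)) (F : G →ᵇ ℂ) (V : ℝ)
    (hV : Tendsto (fun n => ∫ t, ‖F t‖ ^ 2 ∂ν n) atTop (𝓝 V))
    (ha : ∀ χ ∈ S, Tendsto (fun n => ∫ t, (F * star (charBCF χ)) t ∂ν n) atTop (𝓝 (a χ))) :
    Tendsto (fun n => ∫ t, ‖(F - ∑ χ ∈ S, c χ • charBCF χ) t‖ ^ 2 ∂ν n) atTop
      (𝓝 (V + ∑ χ ∈ S, (‖c χ - a χ‖ ^ 2 - ‖a χ‖ ^ 2))) := by
  classical
  -- Characters are subtracted one at a time. Removing a multiple of `χ` leaves the coefficient at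
  -- `ψ ≠ χ` unchanged, since `χ * ψ⁻¹` has mean zero.
  induction S using Finset.induction_on generalizing F V with
  | empty => simpa using hV
  | insert χ S hχ ih =>
    rw [Finset.sum_insert hχ, Finset.sum_insert hχ, ← sub_sub, ← add_assoc]
    refine ih _ _ (tendsto_integral_norm_sub_smul_charBCF_sq hV
      (ha χ (Finset.mem_insert_self _ _)) (c χ)) fun ψ hψ => ?_
    have h1 := ha ψ (Finset.mem_insert_of_mem hψ)
    have hne : χ * ψ⁻¹ ≠ 1 := fun h => hχ (by rwa [mul_inv_eq_one.mp h])
    have h2 := (tendsto_charBCF hν hne).const_mul (c χ)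
    rw [mul_zero] at h2
    have h3 := h1.sub h2
    rw [sub_zero] at h3
    refine h3.congr fun n => ?_
    rw [← integral_const_mul, ← integral_sub ((F * star (charBCF ψ)).integrable _)
      (((charBCF (χ * ψ⁻¹)).integrable _).const_mul _)]
    refine integral_congr_ae (ae_of_all _ fun t => ?_)
    simp only [BoundedContinuousFunction.sub_apply, BoundedContinuousFunction.smul_apply,
      charBCF_apply, smul_eq_mul, BoundedContinuousFunction.mul_apply,
      BoundedContinuousFunction.star_apply, RCLike.star_def, charValue_mul, charValue_inv]
    ring

end Averages

/-! ### Koopman operators and eigenfunctions -/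

section Koopman

open scoped InnerProductSpace

variable {G X : Type*} [AddCommGroup G] [TopologicalSpace G] [MeasurableSpace X] [AddAction G X]
  {m : Measure X}

/-- The Koopman operator `f ↦ f (t +ᵥ ·)` on `L²`. -/
def koopman (hm : ∀ t : G, MeasurePreserving (fun x : X => t +ᵥ x) m m) (t : G) :
    Lp ℂ 2 m →ₗᵢ[ℂ] Lp ℂ 2 m :=
  Lp.compMeasurePreservingₗᵢ ℂ _ (hm t)

theorem coeFn_koopman (hm : ∀ t : G, MeasurePreserving (fun x : X => t +ᵥ x) m m) (t : G)
    (f : Lp ℂ 2 m) : koopman hm t f =ᵐ[m] fun x => f (t +ᵥ x) :=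
  Lp.coeFn_compMeasurePreserving f (hm t)

theorem koopman_eq_smul_iff (hm : ∀ t : G, MeasurePreserving (fun x : X => t +ᵥ x) m m) (t : G)
    (f : Lp ℂ 2 m) (c : ℂ) :
    koopman hm t f = c • f ↔ (fun x => f (t +ᵥ x)) =ᵐ[m] fun x => c * f x := by
  have h1 := coeFn_koopman hm t f
  have h2 := Lp.coeFn_smul c f
  rw [Lp.ext_iff]
  exact ⟨fun h => h1.symm.trans (h.trans h2), fun h => h1.trans (h.trans h2.symm)⟩

theorem isEigenfunction_iff (hm : ∀ t : G, MeasurePreserving (fun x : X => t +ᵥ x) m m)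
    {χ : Dual G} {f : Lp ℂ 2 m} :
    IsEigenfunction m χ f ↔ f ≠ 0 ∧ ∀ t, koopman hm t f = charValue χ t • f := by
  simp only [koopman_eq_smul_iff]
  rfl

theorem inner_eq_zero_of_koopman (hm : ∀ t : G, MeasurePreserving (fun x : X => t +ᵥ x) m m)
    {χ ψ : Dual G} (hne : χ ≠ ψ) {f g : Lp ℂ 2 m} (hf : ∀ t, koopman hm t f = charValue χ t • f)
    (hg : ∀ t, koopman hm t g = charValue ψ t • g) : ⟪f, g⟫_ℂ = 0 := by
  obtain ⟨t, ht⟩ : ∃ t, charValue χ t ≠ charValue ψ t := by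
    by_contra! h
    exact hne (charValue_injective (funext h))
  have h1 := (koopman hm t).inner_map_map f g
  rw [hf, hg, inner_smul_left, inner_smul_right, ← mul_assoc] at h1
  by_contra h0
  have h2 : (starRingEnd ℂ) (charValue χ t) * charValue ψ t = 1 :=
    mul_right_cancel₀ h0 (by rw [h1, one_mul])
  apply ht
  calc charValue χ t = charValue χ t * ((starRingEnd ℂ) (charValue χ t) * charValue ψ t) := by
        rw [h2, mul_one]
    _ = charValue ψ t := by rw [← mul_assoc, charValue_mul_conj, one_mul]

theorem IsEigenfunction.eq_of_isEigenfunction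
    (hm : ∀ t : G, MeasurePreserving (fun x : X => t +ᵥ x) m m)
    {χ ψ : Dual G} {f : Lp ℂ 2 m} (h : IsEigenfunction m χ f) (h' : IsEigenfunction m ψ f) :
    χ = ψ := by
  by_contra hne
  rw [isEigenfunction_iff hm] at h h'
  exact h.1 (inner_self_eq_zero.mp (inner_eq_zero_of_koopman hm hne h.2 h'.2))

end Koopman

/-! ### Fourier coefficients along an orbit and the limit measure -/

section System

open BoundedContinuousFunction
open scoped InnerProductSpace

variable {G X : Type*} [AddCommGroup G] [TopologicalSpace G] [ContinuousAdd G] [MeasurableSpace G]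
  [BorelSpace G] {ν : ℕ → Measure G} [∀ n, IsProbabilityMeasure (ν n)]
  [TopologicalSpace X] [CompactSpace X] [AddAction G X]
  {x₀ : X} (hx : Continuous fun t : G => t +ᵥ x₀)

/-- The values of a continuous function along the orbit of `x₀`. -/
def orbitBCF (hx : Continuous fun t : G => t +ᵥ x₀) (f : C(X, ℂ)) : G →ᵇ ℂ :=
  (mkOfCompact f).compContinuous ⟨fun t => t +ᵥ x₀, hx⟩

@[simp] theorem orbitBCF_apply (f : C(X, ℂ)) (t : G) : orbitBCF hx f t = f (t +ᵥ x₀) := rfl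

theorem approximable_mul_star_charBCF {F : G →ᵇ ℂ} (H : Approximable ν F) (χ : Dual G) :
    Approximable ν (F * star (charBCF χ)) :=
  H.mul (approximable_of_mem_trigBCF (star_mem_trigBCF (charBCF_mem_trigBCF χ)))

/-- The Fourier coefficient `f ↦ lim_n ∫ f (t +ᵥ x₀) conj (χ t) dν_n(t)`. -/
def fourierFunctional (hν : AsymptoticallyInvariant ν)
    (H : ∀ f : C(X, ℂ), Approximable ν (orbitBCF hx f)) (χ : Dual G) : C(X, ℂ) →ₗ[ℂ] ℂ where
  toFun f := mean ν (orbitBCF hx f * star (charBCF χ))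
  map_add' f g := by
    refine tendsto_nhds_unique (tendsto_mean hν (approximable_mul_star_charBCF (H (f + g)) χ))
      (((tendsto_mean hν (approximable_mul_star_charBCF (H f) χ)).add
        (tendsto_mean hν (approximable_mul_star_charBCF (H g) χ))).congr fun n => ?_)
    rw [← integral_add (BoundedContinuousFunction.integrable _ _)
      (BoundedContinuousFunction.integrable _ _)]
    simp [add_mul]
  map_smul' c f := by
    refine tendsto_nhds_unique (tendsto_mean hν (approximable_mul_star_charBCF (H (c • f)) χ))
      (((tendsto_mean hν (approximable_mul_star_charBCF (H f) χ)).const_mul c).congr fun n => ?_)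
    rw [← integral_const_mul]
    simp [mul_assoc]

theorem tendsto_fourierFunctional (hν : AsymptoticallyInvariant ν)
    (H : ∀ f : C(X, ℂ), Approximable ν (orbitBCF hx f)) (χ : Dual G) (f : C(X, ℂ)) :
    Tendsto (fun n => ∫ t, (orbitBCF hx f * star (charBCF χ)) t ∂ν n) atTop
      (𝓝 (fourierFunctional hx hν H χ f)) :=
  tendsto_mean hν (approximable_mul_star_charBCF (H f) χ)

theorem tendsto_fourierFunctional_one (hν : AsymptoticallyInvariant ν)
    (H : ∀ f : C(X, ℂ), Approximable ν (orbitBCF hx f)) (f : C(X, ℂ)) :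
    Tendsto (fun n => ∫ t, f (t +ᵥ x₀) ∂ν n) atTop (𝓝 (fourierFunctional hx hν H 1 f)) := by
  simpa using tendsto_fourierFunctional hx hν H 1 f

variable [T2Space X] [MeasurableSpace X] [BorelSpace X]

theorem exists_measure_of_approximable (hν : AsymptoticallyInvariant ν)
    (H : ∀ f : C(X, ℂ), Approximable ν (orbitBCF hx f)) :
    ∃ m : Measure X, IsProbabilityMeasure m ∧ m.Regular ∧
      ∀ f : C(X, ℂ), Tendsto (fun n => ∫ t, f (t +ᵥ x₀) ∂ν n) atTop (𝓝 (∫ y, f y ∂m)) := by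
  set L := fourierFunctional hx hν H 1 with hL
  let I : C(X, ℝ) → C(X, ℂ) := fun f => ⟨fun x => (f x : ℂ), by fun_prop⟩
  have hI : ∀ f : C(X, ℝ), Tendsto (fun n => ((∫ t, f (t +ᵥ x₀) ∂ν n : ℝ) : ℂ)) atTop
      (𝓝 (L (I f))) := fun f =>
    (tendsto_fourierFunctional_one hx hν H (I f)).congr fun n => integral_ofReal
  -- A limit of real averages is real. This lets the Riesz–Markov theorem be applied to a real
  -- positive functional.
  have hIre : ∀ f : C(X, ℝ), L (I f) = ((L (I f)).re : ℂ) := fun f => by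
    have h := (Complex.continuous_im.tendsto _).comp (hI f)
    refine Complex.ext rfl ?_
    refine tendsto_nhds_unique h ?_
    simp [Function.comp_def]
  have hIre' : ∀ f : C(X, ℝ), Tendsto (fun n => ∫ t, f (t +ᵥ x₀) ∂ν n) atTop
      (𝓝 (L (I f)).re) := fun f => (Complex.continuous_re.tendsto _).comp (hI f)
  let Λ₀ : C_c(X, ℝ) →ₗ[ℝ] ℝ :=
    { toFun := fun f => (L (I f.toContinuousMap)).re
      map_add' := fun f g => by
        rw [← Complex.add_re, ← map_add]
        congr 2
        ext x
        simp [I]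
      map_smul' := fun c f => by
        have : I (c • f).toContinuousMap = (c : ℂ) • I f.toContinuousMap := by
          ext x
          simp [I]
        rw [this, map_smul]
        simp }
  let Λ : C_c(X, ℝ) →ₚ[ℝ] ℝ := PositiveLinearMap.mk₀ Λ₀ fun f hf =>
    ge_of_tendsto' (hIre' f.toContinuousMap) fun n => integral_nonneg fun t => hf (t +ᵥ x₀)
  set m := RealRMK.rieszMeasure Λ with hmdef
  have hreal : ∀ f : C(X, ℝ), ∫ x, f x ∂m = (L (I f)).re := fun f =>
    RealRMK.integral_rieszMeasure Λ ⟨f, HasCompactSupport.of_compactSpace _⟩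
  have hfin : IsFiniteMeasure m := ⟨isCompact_univ.measure_lt_top⟩
  have hprob : IsProbabilityMeasure m := by
    have h1 := hreal 1
    have h2 := tendsto_nhds_unique (hIre' 1) (by simp : Tendsto _ atTop (𝓝 (1 : ℝ)))
    rw [h2] at h1
    simp only [ContinuousMap.one_apply, integral_const, smul_eq_mul, mul_one] at h1
    refine ⟨?_⟩
    rw [← ENNReal.toReal_eq_one_iff]
    exact h1
  refine ⟨m, hprob, inferInstance, fun f => ?_⟩
  let fr : C(X, ℝ) := ⟨fun x => (f x).re, by fun_prop⟩
  let fi : C(X, ℝ) := ⟨fun x => (f x).im, by fun_prop⟩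
  have h1 : f = I fr + Complex.I • I fi := by
    ext x
    simp [I, fr, fi, mul_comm Complex.I, Complex.re_add_im]
  have h2 : ∫ y, f y ∂m = L f := by
    have hif : Integrable (fun y => f y) m := f.continuous.integrable_of_hasCompactSupport
      (HasCompactSupport.of_compactSpace _)
    have h3 := integral_re_add_im hif
    have h4 : L f = L (I fr) + Complex.I * L (I fi) := by
      conv_lhs => rw [h1]
      rw [map_add, map_smul, smul_eq_mul]
    rw [h4, hIre fr, hIre fi, ← hreal fr, ← hreal fi, ← h3, mul_comm Complex.I]
    rfl
  rw [h2]
  exact tendsto_fourierFunctional_one hx hν H f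

end System

/-! ### From approximable orbit functions to eigenfunctions -/

section Forward

open BoundedContinuousFunction
open scoped InnerProductSpace

variable {G X : Type*} [AddCommGroup G] [TopologicalSpace G] [ContinuousAdd G] [MeasurableSpace G]
  [BorelSpace G] {ν : ℕ → Measure G} [∀ n, IsProbabilityMeasure (ν n)]
  [TopologicalSpace X] [CompactSpace X] [T2Space X] [MeasurableSpace X] [BorelSpace X]
  [AddAction G X] {x₀ : X} (hx : Continuous fun t : G => t +ᵥ x₀)
  {m : Measure X} [IsProbabilityMeasure m]

/-- A continuous function as an element of `L²`. -/
abbrev toL2 (m : Measure X) [IsFiniteMeasure m] : C(X, ℂ) →L[ℂ] Lp ℂ 2 m :=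
  ContinuousMap.toLp 2 m ℂ

theorem denseRange_toL2 [m.Regular] : DenseRange (toL2 m) :=
  ContinuousMap.toLp_denseRange ℂ m ℂ (by simp)

theorem inner_toL2_right (e : Lp ℂ 2 m) (f : C(X, ℂ)) :
    ⟪e, toL2 m f⟫_ℂ = ∫ y, f y * (starRingEnd ℂ) (e y) ∂m := by
  rw [L2.inner_def]
  refine integral_congr_ae ?_
  filter_upwards [ContinuousMap.coeFn_toLp (p := 2) (𝕜 := ℂ) m f] with y hy
  rw [hy]
  rfl

/-- Convergence of averages, applied to `f * star f`, identifies mean squares along the orbit with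
squared `L²(m)` norms. -/
theorem tendsto_norm_sq_of_tendsto
    (hm : ∀ f : C(X, ℂ), Tendsto (fun n => ∫ t, f (t +ᵥ x₀) ∂ν n) atTop (𝓝 (∫ y, f y ∂m)))
    (f : C(X, ℂ)) :
    Tendsto (fun n => ∫ t, ‖orbitBCF hx f t‖ ^ 2 ∂ν n) atTop (𝓝 (‖toL2 m f‖ ^ 2)) := by
  have h1 := hm (f * star f)
  have h2 : ∫ y, (f * star f) y ∂m = ((‖toL2 m f‖ ^ 2 : ℝ) : ℂ) := by
    have h3 := ContinuousMap.inner_toLp m f f (𝕜 := ℂ)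
    rw [inner_self_eq_norm_sq_to_K] at h3
    rw [Complex.ofReal_pow]
    exact h3.symm
  rw [h2] at h1
  refine ((Complex.continuous_re.tendsto _).comp h1).congr fun n => ?_
  have h4 : ∀ t, (f * star f) (t +ᵥ x₀) = ((‖orbitBCF hx f t‖ ^ 2 : ℝ) : ℂ) := fun t => by
    rw [← Complex.normSq_eq_norm_sq, ← Complex.mul_conj]
    rfl
  have h5 : ∫ t, (f * star f) (t +ᵥ x₀) ∂ν n = ((∫ t, ‖orbitBCF hx f t‖ ^ 2 ∂ν n : ℝ) : ℂ) := by
    simp only [h4]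
    exact integral_ofReal
  rw [Function.comp, h5, Complex.ofReal_re]

/-- A regular measure is determined by its integrals of continuous functions, and these are limits
of asymptotically invariant averages. -/
theorem measurePreserving_of_tendsto [ContinuousConstVAdd G X] [m.Regular]
    (hx : Continuous fun t : G => t +ᵥ x₀) (hν : AsymptoticallyInvariant ν)
    (hm : ∀ f : C(X, ℂ), Tendsto (fun n => ∫ t, f (t +ᵥ x₀) ∂ν n) atTop (𝓝 (∫ y, f y ∂m)))
    (t : G) : MeasurePreserving (fun x : X => t +ᵥ x) m m := by
  have hc : Continuous fun x : X => t +ᵥ x := continuous_const_vadd t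
  refine ⟨hc.measurable, ?_⟩
  have hreg : (m.map fun x : X => t +ᵥ x).Regular :=
    Measure.Regular.map (μ := m) (Homeomorph.vadd t)
  refine Measure.ext_of_integral_eq_on_compactlySupported fun f => ?_
  rw [integral_map (f := f) hc.aemeasurable (map_continuous f).aestronglyMeasurable]
  let F : C(X, ℂ) := ⟨fun x => (f x : ℂ), by fun_prop⟩
  let F' : C(X, ℂ) := F.comp ⟨_, hc⟩
  have h1 := (hm F').sub (hm F)
  have h2 := hν t (orbitBCF hx F)
  have h3 : ∀ s, shiftBCF t (orbitBCF hx F) s = F' (s +ᵥ x₀) := fun s => by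
    rw [shiftBCF_apply, orbitBCF_apply, add_comm, add_vadd]
    rfl
  simp only [h3] at h2
  have h4 := sub_eq_zero.mp (tendsto_nhds_unique h1 h2)
  have h5 : ((∫ y, f (t +ᵥ y) ∂m : ℝ) : ℂ) = ((∫ y, f y ∂m : ℝ) : ℂ) :=
    integral_ofReal.symm.trans (h4.trans integral_ofReal)
  exact_mod_cast h5

theorem norm_fourierFunctional_le (hν : AsymptoticallyInvariant ν)
    (H : ∀ f : C(X, ℂ), Approximable ν (orbitBCF hx f))
    (hm : ∀ f : C(X, ℂ), Tendsto (fun n => ∫ t, f (t +ᵥ x₀) ∂ν n) atTop (𝓝 (∫ y, f y ∂m)))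
    (χ : Dual G) (f : C(X, ℂ)) : ‖fourierFunctional hx hν H χ f‖ ≤ ‖toL2 m f‖ := by
  refine le_of_forall_gt_imp_ge_of_dense fun δ hδ => ?_
  have hδ0 : 0 < δ := (norm_nonneg _).trans_lt hδ
  have h1 : ∀ᶠ n in atTop, ∫ t, ‖orbitBCF hx f t‖ ^ 2 ∂ν n ≤ δ ^ 2 :=
    ((tendsto_norm_sq_of_tendsto hx hm f).eventually_lt_const
      (pow_lt_pow_left₀ hδ (norm_nonneg _) two_ne_zero)).mono fun _ h => h.le
  refine le_of_tendsto (tendsto_fourierFunctional hx hν H χ f).norm (h1.mono fun n hn => ?_)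
  refine norm_integral_le_of_sq_le (ν n) _ hδ0 (le_of_eq_of_le ?_ hn)
  refine integral_congr_ae (ae_of_all _ fun t => ?_)
  simp

/-- The coefficient functional is a contraction for the `L²` norm on the dense image of the
continuous functions, so it extends to `L²` and is represented by a vector. -/
theorem exists_inner_eq_fourierFunctional [m.Regular] (hν : AsymptoticallyInvariant ν)
    (H : ∀ f : C(X, ℂ), Approximable ν (orbitBCF hx f))
    (hm : ∀ f : C(X, ℂ), Tendsto (fun n => ∫ t, f (t +ᵥ x₀) ∂ν n) atTop (𝓝 (∫ y, f y ∂m)))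
    (χ : Dual G) : ∃ e : Lp ℂ 2 m, ‖e‖ ≤ 1 ∧
      ∀ f : C(X, ℂ), ⟪e, toL2 m f⟫_ℂ = fourierFunctional hx hν H χ f := by
  have hd : DenseRange ((toL2 m).toLinearMap : C(X, ℂ) →ₗ[ℂ] Lp ℂ 2 m) := denseRange_toL2
  have hb : ∀ f, ‖fourierFunctional hx hν H χ f‖ ≤
      1 * ‖((toL2 m).toLinearMap : C(X, ℂ) →ₗ[ℂ] Lp ℂ 2 m) f‖ := fun f => by
    rw [one_mul]
    exact norm_fourierFunctional_le hx hν H hm χ f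
  let T := (fourierFunctional hx hν H χ).extendOfNorm
    ((toL2 m).toLinearMap : C(X, ℂ) →ₗ[ℂ] Lp ℂ 2 m)
  refine ⟨(InnerProductSpace.toDual ℂ (Lp ℂ 2 m)).symm T, ?_, fun f => ?_⟩
  · rw [LinearIsometryEquiv.norm_map]
    exact ContinuousLinearMap.opNorm_le_bound _ zero_le_one
      (LinearMap.norm_extendOfNorm_apply_le hd 1 hb)
  · rw [InnerProductSpace.toDual_symm_apply]
    exact LinearMap.extendOfNorm_eq hd ⟨1, hb⟩ f

theorem fourierFunctional_comp_vadd [ContinuousConstVAdd G X] (hν : AsymptoticallyInvariant ν)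
    (H : ∀ f : C(X, ℂ), Approximable ν (orbitBCF hx f)) (χ : Dual G) (t : G) (f : C(X, ℂ)) :
    fourierFunctional hx hν H χ (f.comp ⟨fun x => t +ᵥ x, continuous_const_vadd t⟩) =
      charValue χ t * fourierFunctional hx hν H χ f := by
  set F := orbitBCF hx f * star (charBCF χ) with hF
  have h1 := tendsto_fourierFunctional hx hν H χ
    (f.comp ⟨fun x => t +ᵥ x, continuous_const_vadd t⟩)
  have h2 := ((hν t F).add (tendsto_fourierFunctional hx hν H χ f)).const_mul (charValue χ t)
  rw [zero_add] at h2
  refine tendsto_nhds_unique h1 (h2.congr fun n => ?_)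
  rw [hF, sub_add_cancel, ← integral_const_mul]
  refine integral_congr_ae (ae_of_all _ fun s => ?_)
  have h3 : f (t +ᵥ s +ᵥ x₀) = f ((s + t) +ᵥ x₀) := by rw [add_comm, add_vadd]
  have h4 := charValue_mul_conj χ t
  simp only [shiftBCF_apply, BoundedContinuousFunction.mul_apply, orbitBCF_apply,
    BoundedContinuousFunction.star_apply, charBCF_apply, RCLike.star_def, charValue_add, map_mul,
    ContinuousMap.comp_apply, ContinuousMap.coe_mk, h3]
  linear_combination (f ((s + t) +ᵥ x₀) * (starRingEnd ℂ) (charValue χ s)) * h4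

theorem koopman_toL2 [ContinuousConstVAdd G X]
    (hp : ∀ t : G, MeasurePreserving (fun x : X => t +ᵥ x) m m) (t : G) (f : C(X, ℂ)) :
    koopman hp t (toL2 m f) =
      toL2 m (f.comp ⟨fun x => t +ᵥ x, continuous_const_vadd t⟩) := by
  refine Lp.ext ((coeFn_koopman hp t _).trans ?_)
  have h1 := (hp t).quasiMeasurePreserving.ae_eq_comp
    (ContinuousMap.coeFn_toLp (p := 2) (𝕜 := ℂ) m f)
  exact h1.trans (ContinuousMap.coeFn_toLp (p := 2) (𝕜 := ℂ) m
    (f.comp ⟨fun x => t +ᵥ x, continuous_const_vadd t⟩)).symm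

/-- Test against `f`, written as the translate by `t` of `g`. The Koopman operator is isometric and
the coefficient of `f` is `χ t` times that of `g`, so both inner products equal the coefficient of
`g`. -/
theorem koopman_eq_of_inner_eq_fourierFunctional [ContinuousConstVAdd G X] [m.Regular]
    (hν : AsymptoticallyInvariant ν) (H : ∀ f : C(X, ℂ), Approximable ν (orbitBCF hx f))
    (hp : ∀ t : G, MeasurePreserving (fun x : X => t +ᵥ x) m m) {χ : Dual G} {e : Lp ℂ 2 m}
    (he : ∀ f : C(X, ℂ), ⟪e, toL2 m f⟫_ℂ = fourierFunctional hx hν H χ f) (t : G) :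
    koopman hp t e = charValue χ t • e := by
  have key : ∀ f : C(X, ℂ), ⟪koopman hp t e, toL2 m f⟫_ℂ = ⟪charValue χ t • e, toL2 m f⟫_ℂ := by
    intro f
    let g : C(X, ℂ) := f.comp ⟨fun x => -t +ᵥ x, continuous_const_vadd (-t)⟩
    have hg : f = g.comp ⟨fun x => t +ᵥ x, continuous_const_vadd t⟩ := by
      ext x
      simp [g]
    have h1 : fourierFunctional hx hν H χ f = charValue χ t * fourierFunctional hx hν H χ g := by
      conv_lhs => rw [hg]
      exact fourierFunctional_comp_vadd hx hν H χ t g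
    rw [inner_smul_left, he, h1]
    conv_lhs => rw [hg]
    rw [← koopman_toL2 hp, LinearIsometry.inner_map_map, he, ← mul_assoc,
      mul_comm ((starRingEnd ℂ) _), charValue_mul_conj, one_mul]
  have h2 : ∀ g : Lp ℂ 2 m, ⟪koopman hp t e, g⟫_ℂ = ⟪charValue χ t • e, g⟫_ℂ := fun g =>
    denseRange_toL2.induction_on (p := fun g => ⟪koopman hp t e, g⟫_ℂ = ⟪charValue χ t • e, g⟫_ℂ) g
      (isClosed_eq (by fun_prop) (by fun_prop)) key
  exact ext_inner_right ℂ h2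

/-- An approximating polynomial with coefficients `c` has limiting squared error `‖f‖ ^ 2 + ∑ ‖c χ -
a χ‖ ^ 2 - ∑ ‖a χ‖ ^ 2`, with `a χ` the Fourier coefficients. This is at most `ε`, and the middle
sum is non-negative. -/
theorem exists_norm_sq_le_sum_fourierFunctional (hν : AsymptoticallyInvariant ν)
    (H : ∀ f : C(X, ℂ), Approximable ν (orbitBCF hx f))
    (hm : ∀ f : C(X, ℂ), Tendsto (fun n => ∫ t, f (t +ᵥ x₀) ∂ν n) atTop (𝓝 (∫ y, f y ∂m)))
    (f : C(X, ℂ)) {ε : ℝ} (hε : 0 < ε) : ∃ S : Finset (Dual G),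
      ‖toL2 m f‖ ^ 2 ≤ ∑ χ ∈ S, ‖fourierFunctional hx hν H χ f‖ ^ 2 + ε := by
  obtain ⟨p, hp, hp'⟩ := H f ε hε
  obtain ⟨c, rfl⟩ := Finsupp.mem_span_range_iff_exists_finsupp.mp hp
  refine ⟨c.support, ?_⟩
  have h1 := tendsto_integral_norm_sub_sum_sq hν (fun χ => fourierFunctional hx hν H χ f) c
    c.support (orbitBCF hx f) _ (tendsto_norm_sq_of_tendsto hx hm f)
    (fun χ _ => tendsto_fourierFunctional hx hν H χ f)
  have h2 := le_of_tendsto h1 hp'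
  rw [Finset.sum_sub_distrib] at h2
  have h3 : 0 ≤ ∑ χ ∈ c.support, ‖c χ - fourierFunctional hx hν H χ f‖ ^ 2 :=
    Finset.sum_nonneg fun _ _ => by positivity
  linarith

theorem exists_eigenfunctions_of_approximable [ContinuousConstVAdd G X]
    (hν : AsymptoticallyInvariant ν) (H : ∀ f : C(X, ℂ), Approximable ν (orbitBCF hx f)) :
    ∃ m : Measure X, ∃ _ : IsProbabilityMeasure m, m.Regular ∧
      ∃ hp : ∀ t : G, MeasurePreserving (fun x : X => t +ᵥ x) m m,
      ∃ e : Dual G → Lp ℂ 2 m,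
        (∀ χ t, koopman hp t (e χ) = charValue χ t • e χ) ∧
        (∀ χ, e χ ≠ 0 → ‖e χ‖ = 1) ∧
        (Submodule.span ℂ (Set.range e)).topologicalClosure = ⊤ ∧
        (∀ χ (f : C(X, ℂ)), Tendsto (fun n => ∫ t, (orbitBCF hx f * star (charBCF χ)) t ∂ν n) atTop
          (𝓝 (⟪e χ, toL2 m f⟫_ℂ))) := by
  obtain ⟨m, hprob, hreg, hm⟩ := exists_measure_of_approximable hx hν H
  have hp := fun t => measurePreserving_of_tendsto hx hν hm t
  choose e hle he using exists_inner_eq_fourierFunctional hx hν H hm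
  have hk : ∀ χ t, koopman hp t (e χ) = charValue χ t • e χ := fun χ t =>
    koopman_eq_of_inner_eq_fourierFunctional hx hν H hp (he χ) t
  have horth : Pairwise fun χ ψ => ⟪e χ, e ψ⟫_ℂ = 0 := fun χ ψ hne =>
    inner_eq_zero_of_koopman hp hne (hk χ) (hk ψ)
  have hP : ∀ f ∈ Set.range (toL2 m), ∀ ε : ℝ, 0 < ε →
      ∃ S : Finset (Dual G), ‖f‖ ^ 2 ≤ ∑ i ∈ S, ‖⟪e i, f⟫_ℂ‖ ^ 2 + ε := by
    rintro _ ⟨f, rfl⟩ ε hε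
    simp only [he]
    exact exists_norm_sq_le_sum_fourierFunctional hx hν H hm f hε
  refine ⟨m, hprob, hreg, hp, e, hk, ?_, ?_, fun χ f => ?_⟩
  · exact norm_eq_one_of_parseval horth hle denseRange_toL2 hP
  · exact span_range_topologicalClosure_eq_top horth hle denseRange_toL2 hP
  · rw [he]
    exact tendsto_fourierFunctional hx hν H χ f

end Forward

/-! ### Consequences of a spanning family with one vector per character -/

section SimpleSpectrum

open scoped InnerProductSpace

variable {G X : Type*} [AddCommGroup G] [TopologicalSpace G] [MeasurableSpace X] [AddAction G X]
  {m : Measure X} [IsProbabilityMeasure m]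
  (hp : ∀ t : G, MeasurePreserving (fun x : X => t +ᵥ x) m m) {e : Dual G → Lp ℂ 2 m}

/-- The difference of the two sides is orthogonal to every `e ψ`, hence zero by density. So every
eigenspace is at most one-dimensional. -/
theorem eq_inner_smul_of_koopman (hk : ∀ χ t, koopman hp t (e χ) = charValue χ t • e χ)
    (h1 : ∀ χ, e χ ≠ 0 → ‖e χ‖ = 1)
    (hspan : (Submodule.span ℂ (Set.range e)).topologicalClosure = ⊤) {χ : Dual G}
    {f : Lp ℂ 2 m} (hf : ∀ t, koopman hp t f = charValue χ t • f) :
    f = ⟪e χ, f⟫_ℂ • e χ := by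
  rw [← sub_eq_zero]
  set g := f - ⟪e χ, f⟫_ℂ • e χ with hg
  have h2 : ∀ ψ, ⟪e ψ, g⟫_ℂ = 0 := by
    intro ψ
    by_cases hψ : ψ = χ
    · subst hψ
      by_cases h0 : e ψ = 0
      · rw [h0, inner_zero_left]
      · rw [hg, inner_sub_right, inner_smul_right, inner_self_eq_norm_sq_to_K, h1 ψ h0]
        simp
    · rw [hg, inner_sub_right, inner_smul_right, inner_eq_zero_of_koopman hp hψ (hk ψ) (hk χ),
        inner_eq_zero_of_koopman hp hψ (hk ψ) hf, mul_zero, sub_zero]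
  have h3 : g ∈ (Submodule.span ℂ (Set.range e))ᗮ := by
    rw [Submodule.mem_orthogonal]
    intro u hu
    induction hu using Submodule.span_induction with
    | mem u hu => obtain ⟨ψ, rfl⟩ := hu; exact h2 ψ
    | zero => exact inner_zero_left _
    | add u v _ _ hu hv => rw [inner_add_left, hu, hv, add_zero]
    | smul c u _ hu => rw [inner_smul_left, hu, mul_zero]
  rw [Submodule.topologicalClosure_eq_top_iff] at hspan
  rwa [hspan, Submodule.mem_bot] at h3

theorem isEigenfunction_const_one (hp : ∀ t : G, MeasurePreserving (fun x : X => t +ᵥ x) m m) :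
    IsEigenfunction m (1 : Dual G) (Lp.const 2 m (1 : ℂ)) := by
  rw [isEigenfunction_iff hp]
  refine ⟨fun h => ?_, fun t => ?_⟩
  · have h1 := Lp.coeFn_const 2 m (1 : ℂ)
    rw [h] at h1
    obtain ⟨x, hx⟩ := (h1.symm.trans (Lp.coeFn_zero ℂ 2 m)).exists
    exact one_ne_zero hx
  · rw [koopman_eq_smul_iff]
    have h1 := Lp.coeFn_const 2 m (1 : ℂ)
    filter_upwards [h1, (hp t).quasiMeasurePreserving.ae_eq_comp h1] with x hx hx'
    simp only [Function.comp] at hx'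
    rw [hx', hx, charValue_one, one_mul]
    rfl

theorem ergodicVAdd_of_span (hk : ∀ χ t, koopman hp t (e χ) = charValue χ t • e χ)
    (h1 : ∀ χ, e χ ≠ 0 → ‖e χ‖ = 1)
    (hspan : (Submodule.span ℂ (Set.range e)).topologicalClosure = ⊤) : ErgodicVAdd G X m where
  measure_preimage_vadd t s hs := (hp t).measure_preimage hs.nullMeasurableSet
  aeconst_of_forall_preimage_vadd_ae_eq := by
    intro s hs hinv
    have hc := eq_inner_smul_of_koopman hp hk h1 hspan (χ := 1)
      ((isEigenfunction_iff hp).mp (isEigenfunction_const_one hp)).2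
    set f : Lp ℂ 2 m := indicatorConstLp 2 hs (measure_ne_top m s) 1 with hf
    have hfs : f =ᵐ[m] s.indicator fun _ => 1 := indicatorConstLp_coeFn
    have hkf : ∀ t : G, koopman hp t f = charValue (1 : Dual G) t • f := by
      intro t
      rw [koopman_eq_smul_iff]
      filter_upwards [hfs, (hp t).quasiMeasurePreserving.ae_eq_comp hfs, (hinv t).mem_iff]
        with x h2 h3 h4
      simp only [Function.comp] at h3
      rw [h2, h3, charValue_one, one_mul]
      by_cases h5 : x ∈ s
      · have : t +ᵥ x ∈ s := h4.mpr h5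
        simp [this, h5]
      · have : t +ᵥ x ∉ s := fun h => h5 (h4.mp h)
        simp [this, h5]
    have hf' := eq_inner_smul_of_koopman hp hk h1 hspan hkf
    -- The indicator of an invariant set and the constant `1` are both fixed vectors, hence
    -- multiples of `e 1`. So the indicator is almost everywhere a constant `b`, and `b = 1` or the
    -- set is null.
    set a := ⟪e 1, Lp.const 2 m (1 : ℂ)⟫_ℂ with ha
    have ha0 : a ≠ 0 := by
      intro h
      rw [h, zero_smul] at hc
      exact (isEigenfunction_const_one hp).1 hc
    have hc2 : e 1 = a⁻¹ • Lp.const 2 m (1 : ℂ) := by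
      rw [hc, smul_smul, inv_mul_cancel₀ ha0, one_smul]
    rw [hc2, smul_smul] at hf'
    set b := ⟪a⁻¹ • Lp.const 2 m (1 : ℂ), f⟫_ℂ * a⁻¹ with hb
    have hfb : f =ᵐ[m] fun _ => b := by
      rw [hf']
      filter_upwards [Lp.coeFn_smul b (Lp.const 2 m (1 : ℂ)), Lp.coeFn_const 2 m (1 : ℂ)]
        with x h2 h3
      rw [h2, Pi.smul_apply, h3]
      simp
    rw [eventuallyConst_set']
    by_cases hb1 : b = 1
    · right
      filter_upwards [hfs, hfb] with x h2 h3
      rw [h3, hb1] at h2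
      refine propext ⟨fun _ => trivial, fun _ => ?_⟩
      by_contra h
      have h' : x ∉ s := h
      simp [h'] at h2
    · left
      filter_upwards [hfs, hfb] with x h2 h3
      rw [h3] at h2
      refine propext ⟨fun h => ?_, fun h => h.elim⟩
      have h' : x ∈ s := h
      simp [h'] at h2
      exact hb1 h2

theorem hasPurePointSpectrum_of_span (hk : ∀ χ t, koopman hp t (e χ) = charValue χ t • e χ)
    (hspan : (Submodule.span ℂ (Set.range e)).topologicalClosure = ⊤) :
    HasPurePointSpectrum G m := by
  rw [HasPurePointSpectrum, eq_top_iff, ← hspan]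
  refine Submodule.topologicalClosure_mono (Submodule.span_le.mpr ?_)
  rintro _ ⟨χ, rfl⟩
  by_cases h : e χ = 0
  · rw [h]
    exact Submodule.zero_mem _
  · exact Submodule.subset_span ⟨χ, (isEigenfunction_iff hp).mpr ⟨h, hk χ⟩⟩

theorem eigenspace_eq (hp : ∀ t : G, MeasurePreserving (fun x : X => t +ᵥ x) m m) (χ : Dual G) :
    eigenspace m χ = {f : Lp ℂ 2 m | ∀ t, koopman hp t f = charValue χ t • f} := by
  ext f
  change (f = 0 ∨ IsEigenfunction m χ f) ↔ ∀ t, koopman hp t f = charValue χ t • f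
  rw [isEigenfunction_iff hp]
  by_cases h : f = 0
  · simp [h]
  · simp [h]

theorem eigenbasis_of_span (hk : ∀ χ t, koopman hp t (e χ) = charValue χ t • e χ)
    (h1 : ∀ χ, e χ ≠ 0 → ‖e χ‖ = 1)
    (hspan : (Submodule.span ℂ (Set.range e)).topologicalClosure = ⊤) {B : Set (Lp ℂ 2 m)}
    (hB : B = {f | f ≠ 0 ∧ f ∈ Set.range e}) {χ : Dual G} (hχ : χ ∈ pointSpectrum G m) :
    Orthonormal ℂ (Subtype.val : {e : Lp ℂ 2 m // e ∈ B ∧ IsEigenfunction m χ e} → Lp ℂ 2 m) ∧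
      ((Submodule.span ℂ {e : Lp ℂ 2 m | e ∈ B ∧ IsEigenfunction m χ e}).topologicalClosure :
        Set (Lp ℂ 2 m)) = eigenspace m χ := by
  have h0 : e χ ≠ 0 := by
    obtain ⟨f, hf⟩ := hχ
    intro h
    have := eq_inner_smul_of_koopman hp hk h1 hspan ((isEigenfunction_iff hp).mp hf).2
    rw [h, smul_zero] at this
    exact hf.1 this
  have hset : {e : Lp ℂ 2 m | e ∈ B ∧ IsEigenfunction m χ e} = {e χ} := by
    ext f
    simp only [Set.mem_ofPred_eq, Set.mem_singleton_iff, hB]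
    constructor
    · rintro ⟨⟨hf0, ψ, rfl⟩, hf⟩
      have : IsEigenfunction m ψ (e ψ) := (isEigenfunction_iff hp).mpr ⟨hf0, hk ψ⟩
      rw [this.eq_of_isEigenfunction hp hf]
    · rintro rfl
      exact ⟨⟨h0, χ, rfl⟩, (isEigenfunction_iff hp).mpr ⟨h0, hk χ⟩⟩
  have hmem : ∀ f, f ∈ B ∧ IsEigenfunction m χ f → f = e χ := fun f hf => by
    have : f ∈ ({e χ} : Set (Lp ℂ 2 m)) := hset ▸ hf
    exact this
  refine ⟨⟨fun f => ?_, fun f g hne => ?_⟩, ?_⟩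
  · rw [hmem _ f.2, h1 χ h0]
  · exact absurd (Subtype.ext ((hmem _ f.2).trans (hmem _ g.2).symm)) hne
  · rw [hset, eigenspace_eq hp]
    rw [(Submodule.closed_of_finiteDimensional
      (Submodule.span ℂ {e χ})).submodule_topologicalClosure_eq]
    ext f
    rw [SetLike.mem_coe, Submodule.mem_span_singleton]
    constructor
    · rintro ⟨c, rfl⟩ t
      rw [map_smul, hk, smul_comm]
    · intro hf
      exact ⟨_, (eq_inner_smul_of_koopman hp hk h1 hspan hf).symm⟩

end SimpleSpectrum

/-! ### From a Wiener–Wintner point to approximable orbit functions -/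

section Converse

open BoundedContinuousFunction
open scoped InnerProductSpace

variable {G X : Type*} [AddCommGroup G] [TopologicalSpace G] [ContinuousAdd G] [MeasurableSpace G]
  [BorelSpace G] {ν : ℕ → Measure G} [∀ n, IsProbabilityMeasure (ν n)]
  [TopologicalSpace X] [CompactSpace X] [T2Space X] [MeasurableSpace X] [BorelSpace X]
  [AddAction G X] {x₀ : X} (hx : Continuous fun t : G => t +ᵥ x₀)
  {m : Measure X} [IsProbabilityMeasure m]

theorem toL2_one : toL2 m 1 = Lp.const 2 m (1 : ℂ) := by
  refine Lp.ext ((ContinuousMap.coeFn_toLp (p := 2) (𝕜 := ℂ) m 1).trans ?_)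
  exact (Lp.coeFn_const 2 m (1 : ℂ)).symm

theorem approximable_of_tendsto_inner [m.Regular] (hν : AsymptoticallyInvariant ν)
    (hp : ∀ t : G, MeasurePreserving (fun x : X => t +ᵥ x) m m) (hpp : HasPurePointSpectrum G m)
    {B : Set (Lp ℂ 2 m)}
    (hB : ∀ χ ∈ pointSpectrum G m,
      Orthonormal ℂ (Subtype.val : {e : Lp ℂ 2 m // e ∈ B ∧ IsEigenfunction m χ e} → Lp ℂ 2 m) ∧
      ((Submodule.span ℂ {e : Lp ℂ 2 m | e ∈ B ∧ IsEigenfunction m χ e}).topologicalClosure :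
        Set (Lp ℂ 2 m)) = eigenspace m χ)
    (hlim : ∀ f : C(X, ℂ), ∀ e ∈ B, ∀ χ : Dual G, IsEigenfunction m χ e →
      Tendsto (fun n => ∫ t, (orbitBCF hx f * star (charBCF χ)) t ∂ν n) atTop
        (𝓝 (⟪e, toL2 m f⟫_ℂ))) (f : C(X, ℂ)) :
    Approximable ν (orbitBCF hx f) := by
  -- Otherwise the eigenspace would be the closed span of the empty set, which is zero.
  have hex : ∀ χ : pointSpectrum G m, ∃ e, e ∈ B ∧ IsEigenfunction m (χ : Dual G) e := by
    intro χ
    by_contra! hno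
    have hempty : {e : Lp ℂ 2 m | e ∈ B ∧ IsEigenfunction m (χ : Dual G) e} = ∅ :=
      Set.eq_empty_iff_forall_notMem.mpr fun e he => hno e he.1 he.2
    have h := (hB χ χ.2).2
    obtain ⟨g, hg⟩ := χ.2
    have hg' : g ∈ eigenspace m (χ : Dual G) := Or.inr hg
    rw [← h, hempty, Submodule.span_empty] at hg'
    have : g ∈ ((⊥ : Submodule ℂ (Lp ℂ 2 m)).topologicalClosure) := hg'
    rw [(Submodule.closed_of_finiteDimensional
      (⊥ : Submodule ℂ (Lp ℂ 2 m))).submodule_topologicalClosure_eq, Submodule.mem_bot] at this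
    exact hg.1 this
  choose e heB he using hex
  -- The averages in `hlim` depend on `χ` only, so two members of `B` with the same eigenvalue have
  -- equal inner products with a dense set.
  have huniq : ∀ (χ : pointSpectrum G m) (g), g ∈ B → IsEigenfunction m (χ : Dual G) g →
      g = e χ := by
    intro χ g hgB hg
    have h1 : ∀ F : C(X, ℂ), ⟪g, toL2 m F⟫_ℂ = ⟪e χ, toL2 m F⟫_ℂ := fun F =>
      tendsto_nhds_unique (hlim F g hgB χ hg) (hlim F (e χ) (heB χ) χ (he χ))
    refine ext_inner_right ℂ fun v => ?_
    exact denseRange_toL2.induction_on (p := fun v => ⟪g, v⟫_ℂ = ⟪e χ, v⟫_ℂ) v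
      (isClosed_eq (by fun_prop) (by fun_prop)) h1
  have hnorm : ∀ χ, ‖e χ‖ = 1 := fun χ => (hB χ χ.2).1.1 ⟨e χ, heB χ, he χ⟩
  have hspanχ : ∀ (χ : pointSpectrum G m) (g), IsEigenfunction m (χ : Dual G) g →
      ∃ c : ℂ, c • e χ = g := by
    intro χ g hg
    have hset : {e : Lp ℂ 2 m | e ∈ B ∧ IsEigenfunction m (χ : Dual G) e} = {e χ} := by
      refine Set.eq_singleton_iff_unique_mem.mpr ⟨⟨heB χ, he χ⟩, fun g hg => ?_⟩
      exact huniq χ g hg.1 hg.2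
    have hg' : g ∈ eigenspace m (χ : Dual G) := Or.inr hg
    rw [← (hB χ χ.2).2, hset, (Submodule.closed_of_finiteDimensional
      (Submodule.span ℂ {e χ})).submodule_topologicalClosure_eq] at hg'
    exact Submodule.mem_span_singleton.mp hg'
  have horth : Orthonormal ℂ e := by
    refine ⟨hnorm, fun χ ψ hne => ?_⟩
    exact inner_eq_zero_of_koopman hp (Subtype.coe_ne_coe.mpr hne)
      ((isEigenfunction_iff hp).mp (he χ)).2 ((isEigenfunction_iff hp).mp (he ψ)).2
  have hdense : ⊤ ≤ (Submodule.span ℂ (Set.range e)).topologicalClosure := by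
    rw [← hpp]
    refine Submodule.topologicalClosure_mono (Submodule.span_le.mpr ?_)
    rintro g ⟨χ, hg⟩
    obtain ⟨c, hc⟩ := hspanχ ⟨χ, g, hg⟩ g hg
    rw [← hc]
    exact Submodule.smul_mem _ _ (Submodule.subset_span ⟨_, rfl⟩)
  -- The basis vector for the trivial character is a priori only proportional to the constant `1`.
  -- The limit in `hlim` for the function `1` fixes the factor, so that `hlim` becomes convergence
  -- to `m`.
  have hm : ∀ f : C(X, ℂ), Tendsto (fun n => ∫ t, f (t +ᵥ x₀) ∂ν n) atTop
      (𝓝 (∫ y, f y ∂m)) := by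
    let χ₁ : pointSpectrum G m := ⟨1, _, isEigenfunction_const_one hp⟩
    obtain ⟨c, hc⟩ := hspanχ χ₁ _ (isEigenfunction_const_one hp)
    have hl : ∀ f : C(X, ℂ), Tendsto (fun n => ∫ t, f (t +ᵥ x₀) ∂ν n) atTop
        (𝓝 (⟪e χ₁, toL2 m f⟫_ℂ)) := fun f => by
      simpa [χ₁] using hlim f (e χ₁) (heB χ₁) χ₁ (he χ₁)
    have h1 : ⟪e χ₁, toL2 m 1⟫_ℂ = 1 := tendsto_nhds_unique (hl 1) (by simp)
    rw [toL2_one, ← hc, inner_smul_right, inner_self_eq_norm_sq_to_K, hnorm] at h1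
    have hc1 : c = 1 := by simpa using h1
    rw [hc1, one_smul] at hc
    intro f
    have h2 := hl f
    rw [hc, inner_toL2_right] at h2
    have h3 : ∫ y, f y * (starRingEnd ℂ) (Lp.const 2 m (1 : ℂ) y) ∂m = ∫ y, f y ∂m := by
      refine integral_congr_ae ?_
      filter_upwards [Lp.coeFn_const 2 m (1 : ℂ)] with y hy
      rw [hy]
      simp
    rwa [h3] at h2
  intro ε hε
  let b := HilbertBasis.mk horth hdense
  have hsum : HasSum (fun χ => ‖⟪e χ, toL2 m f⟫_ℂ‖ ^ 2) (‖toL2 m f‖ ^ 2) := by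
    have h1 := b.hasSum_inner_mul_inner (toL2 m f) (toL2 m f)
    rw [inner_self_eq_norm_sq_to_K] at h1
    have h2 := Complex.hasSum_re h1
    have h3 : (((‖toL2 m f‖ : ℝ) : ℂ) ^ 2).re = ‖toL2 m f‖ ^ 2 := by
      rw [← Complex.ofReal_pow, Complex.ofReal_re]
    refine (h3 ▸ h2).congr_fun fun χ => ?_
    rw [show b χ = e χ from congrFun (HilbertBasis.coe_mk horth hdense) χ,
      ← inner_conj_symm (toL2 m f), mul_comm, Complex.mul_conj, Complex.normSq_eq_norm_sq,
      Complex.ofReal_re]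
  obtain ⟨S, hS⟩ := (hsum.eventually_const_lt (sub_lt_self (‖toL2 m f‖ ^ 2) hε)).exists
  classical
  -- The value `0` off the point spectrum is immaterial, as only characters from `S` are used.
  let a : Dual G → ℂ := fun χ =>
    if h : χ ∈ pointSpectrum G m then ⟪e ⟨χ, h⟩, toL2 m f⟫_ℂ else 0
  have ha : ∀ χ : pointSpectrum G m, a χ = ⟪e χ, toL2 m f⟫_ℂ := fun χ => dif_pos χ.2
  have hT := tendsto_integral_norm_sub_sum_sq hν a a (S.map (Function.Embedding.subtype _))
    (orbitBCF hx f) _ (tendsto_norm_sq_of_tendsto hx hm f) fun χ hχ => by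
      obtain ⟨ψ, _, rfl⟩ := Finset.mem_map.mp hχ
      rw [Function.Embedding.coe_subtype, ha]
      exact hlim f (e ψ) (heB ψ) ψ (he ψ)
  refine ⟨_, Submodule.sum_mem _ fun χ _ => Submodule.smul_mem _ (a χ) (charBCF_mem_trigBCF χ),
    (hT.eventually_lt_const ?_).mono fun _ h => h.le⟩
  rw [Finset.sum_map]
  simp only [Function.Embedding.coe_subtype, ha, sub_self, norm_zero, zero_sub, ne_eq,
    OfNat.ofNat_ne_zero, not_false_eq_true, zero_pow, Finset.sum_neg_distrib]
  linarith

end Converse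

/-! ### Averages over van Hove sequences and the Besicovitch seminorm -/

section VanHove

open BoundedContinuousFunction ProbabilityTheory

variable {G : Type*} [AddCommGroup G] [TopologicalSpace G] [IsTopologicalAddGroup G]
  [MeasurableSpace G] [BorelSpace G] {θ : Measure G} [θ.IsAddHaarMeasure] {A : ℕ → Set G}

theorem IsVanHove.measure_ne_zero (hA : IsVanHove θ A) (n : ℕ) : θ (A n) ≠ 0 :=
  ((hA.isOpen n).measure_pos θ (hA.nonempty n)).ne'

theorem IsVanHove.measure_ne_top (hA : IsVanHove θ A) (n : ℕ) : θ (A n) ≠ ∞ :=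
  ((measure_mono subset_closure).trans_lt (hA.isCompact_closure n).measure_lt_top).ne

theorem IsVanHove.isProbabilityMeasure_cond (hA : IsVanHove θ A) (n : ℕ) :
    IsProbabilityMeasure (cond θ (A n)) :=
  cond_isProbabilityMeasure_of_finite (hA.measure_ne_zero n) (hA.measure_ne_top n)

theorem integral_cond_eq (s : Set G) (h : G → ℂ) :
    ∫ t, h t ∂(cond θ s) = ((θ.real s : ℂ))⁻¹ * ∫ t in s, h t ∂θ := by
  rw [ProbabilityTheory.cond, integral_smul_measure, ENNReal.toReal_inv, Complex.real_smul, Complex.ofReal_inv]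
  rfl

theorem IsVanHove.tendsto_measure_preimage_diff (hA : IsVanHove θ A) (s : G) :
    Tendsto (fun n => θ.real (((fun t => t + s) ⁻¹' A n) \ A n) / θ.real (A n)) atTop (𝓝 0) := by
  have h1 : Tendsto (fun n => θ (((fun t => t + s) ⁻¹' A n) \ A n) / θ (A n)) atTop (𝓝 0) := by
    refine tendsto_of_tendsto_of_tendsto_of_le_of_le tendsto_const_nhds
      -- With `K = {-s}`, the part of the translate `A n - s` outside `A n` lies in the first piece
      -- of the boundary.
      (hA.tendsto_boundary {-s} isCompact_singleton) (fun _ => zero_le) fun n => ?_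
    refine ENNReal.div_le_div_right (measure_mono ?_) _
    rintro t ⟨ht, ht'⟩
    refine Or.inl ⟨subset_closure ?_, ht'⟩
    exact ⟨t + s, ht, -s, rfl, by simp⟩
  have h2 := (ENNReal.tendsto_toReal ENNReal.zero_ne_top).comp h1
  rw [ENNReal.toReal_zero] at h2
  exact h2.congr fun n => ENNReal.toReal_div _ _

/-- The two integrals differ only on the symmetric difference of `A n` and its translate `S = A n +
s`. Its halves are controlled by the boundary estimate for `-s` and, after translating back, for
`s`. -/
theorem IsVanHove.asymptoticallyInvariant (hA : IsVanHove θ A) :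
    AsymptoticallyInvariant fun n => cond θ (A n) := by
  intro s h
  have hlim := ((hA.tendsto_measure_preimage_diff s).add
    (hA.tendsto_measure_preimage_diff (-s))).const_mul ‖h‖
  rw [add_zero, mul_zero] at hlim
  refine squeeze_zero_norm (fun n => ?_) hlim
  set S := (fun t => t + -s) ⁻¹' A n with hS
  have hmS : MeasurableSet S :=
    ((hA.isOpen n).preimage (continuous_id.add continuous_const)).measurableSet
  have hmA : MeasurableSet (A n) := (hA.isOpen n).measurableSet
  have hpre : (fun t => t + s) ⁻¹' S = A n := by
    ext t
    simp [hS]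
  have hmp := measurePreserving_add_right θ s
  have hemb : MeasurableEmbedding fun t : G => t + s :=
    (Homeomorph.addRight s).measurableEmbedding
  have h1 : ∫ t in A n, h (t + s) ∂θ = ∫ t in S, h t ∂θ := by
    rw [← hmp.setIntegral_preimage_emb hemb h S, hpre]
  have hθA : θ (A n) ≠ ∞ := hA.measure_ne_top n
  have hθS : θ S = θ (A n) := by
    rw [← hpre, hmp.measure_preimage hmS.nullMeasurableSet]
  have hdiff : θ.real (A n \ S) = θ.real (((fun t => t + s) ⁻¹' A n) \ A n) := by
    rw [measureReal_def, measureReal_def, ← hmp.measure_preimage (hmA.diff hmS).nullMeasurableSet,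
      Set.preimage_sdiff, hpre]
  have hiA : IntegrableOn h (A n) θ :=
    Measure.integrableOn_of_bounded hθA h.continuous.aestronglyMeasurable
      (ae_of_all _ fun t => h.norm_coe_le_norm t)
  have hiS : IntegrableOn h S θ :=
    Measure.integrableOn_of_bounded (hθS ▸ hθA) h.continuous.aestronglyMeasurable
      (ae_of_all _ fun t => h.norm_coe_le_norm t)
  have h2 := integral_inter_add_sdiff hmA hiS
  have h3 := integral_inter_add_sdiff hmS hiA
  rw [Set.inter_comm] at h3
  have hb1 : ‖∫ t in S \ A n, h t ∂θ‖ ≤ ‖h‖ * θ.real (S \ A n) :=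
    norm_setIntegral_le_of_norm_le_const
      ((measure_mono Set.sdiff_subset).trans_lt (hθS ▸ hθA.lt_top)) fun t _ => h.norm_coe_le_norm t
  have hb2 : ‖∫ t in A n \ S, h t ∂θ‖ ≤ ‖h‖ * θ.real (A n \ S) :=
    norm_setIntegral_le_of_norm_le_const
      ((measure_mono Set.sdiff_subset).trans_lt hθA.lt_top) fun t _ => h.norm_coe_le_norm t
  have h4 : ∫ t, shiftBCF s h t ∂(cond θ (A n)) - ∫ t, h t ∂(cond θ (A n)) =
      ((θ.real (A n) : ℂ))⁻¹ * (∫ t in S \ A n, h t ∂θ - ∫ t in A n \ S, h t ∂θ) := by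
    rw [integral_cond_eq, integral_cond_eq, ← mul_sub]
    simp only [shiftBCF_apply]
    rw [h1, ← h2, ← h3]
    ring
  rw [h4, norm_mul, norm_inv, Complex.norm_real, Real.norm_of_nonneg measureReal_nonneg]
  calc (θ.real (A n))⁻¹ * ‖∫ t in S \ A n, h t ∂θ - ∫ t in A n \ S, h t ∂θ‖
      ≤ (θ.real (A n))⁻¹ * (‖h‖ * θ.real (S \ A n) + ‖h‖ * θ.real (A n \ S)) := by
        gcongr
        exact (norm_sub_le _ _).trans (add_le_add hb1 hb2)
    _ = _ := by
        rw [hdiff]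
        ring

theorem IsVanHove.lintegral_cond_eq (hA : IsVanHove θ A) (n : ℕ) (h : G →ᵇ ℂ) :
    (θ (A n))⁻¹ * ∫⁻ t in A n, ‖h t‖ₑ ^ 2 ∂θ =
      ENNReal.ofReal (∫ t, ‖h t‖ ^ 2 ∂(cond θ (A n))) := by
  have := hA.isProbabilityMeasure_cond n
  rw [ofReal_integral_eq_lintegral_ofReal (integrable_norm_sq _ h) (ae_of_all _ fun t => by
    positivity)]
  simp only [ENNReal.ofReal_pow (norm_nonneg _), ofReal_norm]
  rw [ProbabilityTheory.cond, lintegral_smul_measure]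
  rfl

theorem IsVanHove.besicovitchSeminorm_eq (hA : IsVanHove θ A) (h : G →ᵇ ℂ) :
    besicovitchSeminorm θ A h =
      limsup (fun n => ENNReal.ofReal (√(∫ t, ‖h t‖ ^ 2 ∂(cond θ (A n))))) atTop := by
  unfold besicovitchSeminorm
  congr 1
  ext n
  rw [hA.lintegral_cond_eq, ENNReal.ofReal_rpow_of_nonneg (integral_nonneg fun t => by positivity)
    (by norm_num), Real.sqrt_eq_rpow]

theorem IsVanHove.isBesicovitchAP_iff (hA : IsVanHove θ A) (h : G →ᵇ ℂ) :
    IsBesicovitchAP θ A h ↔ Approximable (fun n => cond θ (A n)) h := by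
  constructor
  · intro H ε hε
    -- Halving makes the `limsup` strictly smaller than `√ε`, which yields a bound for all large
    -- `n`.
    obtain ⟨_, hp, hp'⟩ := H.approx (√ε / 2) (by positivity)
    obtain ⟨p, hpt, rfl⟩ := mem_trigPoly_iff.mp hp
    refine ⟨p, hpt, ?_⟩
    change besicovitchSeminorm θ A (h - p : G →ᵇ ℂ) ≤ _ at hp'
    rw [hA.besicovitchSeminorm_eq] at hp'
    have hlt : ENNReal.ofReal (√ε / 2) < ENNReal.ofReal √ε := by
      have := Real.sqrt_pos.mpr hε
      exact (ENNReal.ofReal_lt_ofReal_iff this).mpr (by linarith)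
    refine (eventually_lt_of_limsup_lt (hp'.trans_lt hlt)).mono fun n hn => ?_
    have := (ENNReal.ofReal_lt_ofReal_iff (Real.sqrt_pos.mpr hε)).mp hn
    exact ((Real.sqrt_lt_sqrt_iff (integral_nonneg fun t => by positivity)).mp this).le
  · intro H
    refine ⟨h.continuous.measurable, ⟨‖h‖, h.norm_coe_le_norm⟩, fun ε hε => ?_⟩
    obtain ⟨p, hp, hp'⟩ := H (ε ^ 2) (by positivity)
    refine ⟨p, mem_trigPoly_iff.mpr ⟨p, hp, rfl⟩, ?_⟩
    change besicovitchSeminorm θ A (h - p : G →ᵇ ℂ) ≤ _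
    rw [hA.besicovitchSeminorm_eq]
    refine limsup_le_of_le (by isBoundedDefault) (hp'.mono fun n hn => ?_)
    exact ENNReal.ofReal_le_ofReal (Real.sqrt_le_iff.mpr ⟨hε.le, hn⟩)

end VanHove

/-! ### Reduction to a separating family -/

section StoneWeierstrass

open BoundedContinuousFunction

variable {G X : Type*} [AddCommGroup G] [TopologicalSpace G] [ContinuousAdd G]
  [MeasurableSpace G] [BorelSpace G] {ν : ℕ → Measure G} [∀ n, IsProbabilityMeasure (ν n)]
  [TopologicalSpace X] [CompactSpace X] [AddAction G X] {x₀ : X}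

theorem orbitBCF_mul (hx : Continuous fun t : G => t +ᵥ x₀) (f g : C(X, ℂ)) :
    orbitBCF hx (f * g) = orbitBCF hx f * orbitBCF hx g := rfl

theorem orbitBCF_add (hx : Continuous fun t : G => t +ᵥ x₀) (f g : C(X, ℂ)) :
    orbitBCF hx (f + g) = orbitBCF hx f + orbitBCF hx g := rfl

theorem orbitBCF_star (hx : Continuous fun t : G => t +ᵥ x₀) (f : C(X, ℂ)) :
    orbitBCF hx (star f) = star (orbitBCF hx f) := rfl

theorem orbitBCF_algebraMap (hx : Continuous fun t : G => t +ᵥ x₀) (c : ℂ) :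
    orbitBCF hx (algebraMap ℂ C(X, ℂ) c) = c • charBCF 1 := by
  ext t
  simp [Algebra.algebraMap_eq_smul_one]

theorem approximable_of_separatesPoints (hx : Continuous fun t : G => t +ᵥ x₀) {T : Set C(X, ℂ)}
    (hT : ∀ f ∈ T, Approximable ν (orbitBCF hx f))
    (hsep : ∀ x y : X, x ≠ y → ∃ f ∈ T, f x ≠ f y) (f : C(X, ℂ)) :
    Approximable ν (orbitBCF hx f) := by
  let S : StarSubalgebra ℂ C(X, ℂ) :=
    { carrier := {f | Approximable ν (orbitBCF hx f)}
      mul_mem' := fun {f g} hf hg => by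
        rw [Set.mem_ofPred_eq, orbitBCF_mul]
        exact Approximable.mul hf hg
      add_mem' := fun {f g} hf hg => by
        rw [Set.mem_ofPred_eq, orbitBCF_add]
        exact Approximable.add hf hg
      algebraMap_mem' := fun c => by
        rw [Set.mem_ofPred_eq, orbitBCF_algebraMap]
        exact approximable_of_mem_trigBCF (Submodule.smul_mem _ _ (charBCF_mem_trigBCF 1))
      star_mem' := fun {f} hf => by
        rw [Set.mem_ofPred_eq, orbitBCF_star]
        exact Approximable.star hf }
  have hsep' : S.SeparatesPoints := fun x y hne => by
    obtain ⟨f, hf, hfxy⟩ := hsep x y hne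
    exact ⟨f, ⟨f, hT f hf, rfl⟩, hfxy⟩
  have htop := ContinuousMap.starSubalgebra_topologicalClosure_eq_top_of_separatesPoints S hsep'
  have hf : f ∈ closure (S : Set C(X, ℂ)) := by
    rw [← StarSubalgebra.topologicalClosure_coe, htop]
    trivial
  refine Approximable.of_forall_norm_sub_le fun ε hε => ?_
  obtain ⟨g, hg, hfg⟩ := Metric.mem_closure_iff.mp hf ε hε
  refine ⟨_, hg, (BoundedContinuousFunction.norm_le hε.le).mpr fun t => ?_⟩
  rw [dist_eq_norm] at hfg
  exact ((f - g).norm_coe_le_norm (t +ᵥ x₀)).trans hfg.le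

end StoneWeierstrass

/-! ### Compactness of the hull and continuity of the orbit map -/

namespace RadonMeasure

open BoundedContinuousFunction

section Topology

variable {G : Type*} [TopologicalSpace G]

theorem isEmbedding_eval :
    IsEmbedding fun (μ : RadonMeasure G) (φ : C_c(G, ℂ)) => μ.toLinearMap φ :=
  ⟨⟨rfl⟩, fun _ _ h => ext fun φ => congrFun h φ⟩

instance : T2Space (RadonMeasure G) :=
  isEmbedding_eval.t2Space

theorem continuous_eval (φ : C_c(G, ℂ)) : Continuous fun μ : RadonMeasure G => μ.toLinearMap φ :=
  (continuous_apply φ).comp isEmbedding_eval.continuous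

theorem exists_norm_le (φ : C_c(G, ℂ)) : ∃ M : ℝ, ∀ s, ‖φ s‖ ≤ M := by
  obtain ⟨M, hM⟩ := φ.hasCompactSupport.exists_bound_of_continuous φ.continuous
  exact ⟨M, hM⟩

/-- Tychonoff: the evaluations lie in a product of closed discs, and linearity and the bounds are
closed conditions. The bounds make every pointwise limit a Radon measure again. -/
theorem isCompact_of_bounds (C : Set G → ℝ) :
    IsCompact {ν : RadonMeasure G | ∀ K : Set G, IsCompact K → ∀ φ : C_c(G, ℂ), tsupport φ ⊆ K →
      ∀ M : ℝ, (∀ s, ‖φ s‖ ≤ M) → ‖ν.toLinearMap φ‖ ≤ C K * M} := by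
  rw [isEmbedding_eval.isCompact_iff]
  choose M hM using fun φ : C_c(G, ℂ) => exists_norm_le φ
  have hcomp : IsCompact (Set.univ.pi fun φ : C_c(G, ℂ) =>
      Metric.closedBall (0 : ℂ) (C (tsupport φ) * M φ)) :=
    isCompact_univ_pi fun φ => isCompact_closedBall _ _
  set Z : Set (C_c(G, ℂ) → ℂ) := {u | (∀ φ ψ, u (φ + ψ) = u φ + u ψ) ∧
    (∀ (c : ℂ) (φ), u (c • φ) = c • u φ) ∧
    ∀ K : Set G, IsCompact K → ∀ φ : C_c(G, ℂ), tsupport φ ⊆ K →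
      ∀ M : ℝ, (∀ s, ‖φ s‖ ≤ M) → ‖u φ‖ ≤ C K * M} with hZ
  have hclosed : IsClosed Z := by
    simp only [hZ, Set.ofPred_and, Set.ofPred_forall]
    refine IsClosed.inter (isClosed_iInter fun φ => isClosed_iInter fun ψ =>
      isClosed_eq (by fun_prop) (by fun_prop)) (IsClosed.inter (isClosed_iInter fun c =>
      isClosed_iInter fun φ => isClosed_eq (by fun_prop) (by fun_prop)) ?_)
    exact isClosed_iInter fun K => isClosed_iInter fun _ => isClosed_iInter fun φ =>
      isClosed_iInter fun _ => isClosed_iInter fun M => isClosed_iInter fun _ =>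
      isClosed_le (by fun_prop) continuous_const
  refine (hcomp.of_isClosed_subset hclosed fun u hu φ _ => ?_).of_isClosed_subset ?_ ?_
  · rw [mem_closedBall_zero_iff]
    exact hu.2.2 _ φ.hasCompactSupport φ subset_rfl _ (hM φ)
  · convert hclosed using 1
    ext u
    constructor
    · rintro ⟨ν, hν, rfl⟩
      exact ⟨fun φ ψ => map_add _ _ _, fun c φ => map_smul _ _ _, hν⟩
    · rintro ⟨h1, h2, h3⟩
      exact ⟨⟨⟨⟨u, h1⟩, h2⟩, fun K hK => ⟨C K, fun φ hφ M hM => h3 K hK φ hφ M hM⟩⟩, h3, rfl⟩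
  · rintro _ ⟨ν, hν, rfl⟩
    exact ⟨fun φ ψ => map_add _ _ _, fun c φ => map_smul _ _ _, hν⟩

end Topology

variable {G : Type*} [TopologicalSpace G] [AddCommGroup G] [IsTopologicalAddGroup G]

/-- Here `reflectFun 0 φ` is `s ↦ φ (-s)`: evaluating at `φ` along the orbit is convolving with the
reflected test function. -/
theorem vadd_eq_conv (μ : RadonMeasure G) (t : G) (φ : C_c(G, ℂ)) :
    (t +ᵥ μ).toLinearMap φ = μ.conv (reflectFun 0 φ) t := by
  rw [vadd_apply, conv]
  congr 1
  ext s
  change φ (s - t) = φ (0 - (t - s))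
  congr 1
  abel

theorem vadd_reflectFun_zero (μ : RadonMeasure G) (t : G) (φ : C_c(G, ℂ)) :
    (t +ᵥ μ).toLinearMap (reflectFun 0 φ) = μ.conv φ t := by
  rw [vadd_apply, conv]
  congr 1
  ext s
  change φ (0 - (s - t)) = φ (t - s)
  congr 1
  abel

/-- The bounded continuous functions vanishing outside `K`. -/
def vanishingOutside (K : Set G) : Submodule ℂ (G →ᵇ ℂ) where
  carrier := {f | ∀ s ∉ K, f s = 0}
  add_mem' hf hg s hs := by simp [hf s hs, hg s hs]
  zero_mem' _ _ := rfl
  smul_mem' c f hf s hs := by simp [hf s hs]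

theorem isClosed_vanishingOutside (K : Set G) :
    IsClosed (vanishingOutside K : Set (G →ᵇ ℂ)) := by
  have : (vanishingOutside K : Set (G →ᵇ ℂ)) = ⋂ s, ⋂ (_ : s ∉ K), {f | f s = 0} := by
    ext f
    simp only [Set.mem_iInter]
    rfl
  rw [this]
  exact isClosed_iInter fun s => isClosed_iInter fun _ =>
    isClosed_eq (continuous_eval_const s) continuous_const

variable [T2Space G]

theorem tsupport_subset_of_vanishing {K : Set G} (hK : IsCompact K) {f : G → ℂ}
    (hf : ∀ s ∉ K, f s = 0) : tsupport f ⊆ K :=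
  closure_minimal (fun s hs => by_contra fun h => hs (hf s h)) hK.isClosed

/-- A function in `vanishingOutside K` as an element of `C_c(G)`. -/
def ofVanishingOutside {K : Set G} (hK : IsCompact K) (f : vanishingOutside K) : C_c(G, ℂ) where
  toFun := f.1
  continuous_toFun := f.1.continuous
  hasCompactSupport' := hK.of_isClosed_subset (isClosed_tsupport _)
    (tsupport_subset_of_vanishing hK f.2)

/-- The restriction of a Radon measure to the Banach space of functions vanishing outside `K`. -/
def restrictCLM (μ : RadonMeasure G) {K : Set G} (hK : IsCompact K) :
    vanishingOutside K →L[ℂ] ℂ :=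
  LinearMap.mkContinuousOfExistsBound
    { toFun := fun f => μ.toLinearMap (ofVanishingOutside hK f)
      map_add' := fun f g => by
        rw [← map_add]
        rfl
      map_smul' := fun c f => by
        rw [RingHom.id_apply, ← map_smul]
        rfl } <| by
    obtain ⟨C, hC⟩ := μ.bounded_of_isCompact K hK
    exact ⟨C, fun f => hC (ofVanishingOutside hK f) (tsupport_subset_of_vanishing hK f.2) _
      fun s => f.1.norm_coe_le_norm s⟩

/-- Uniform boundedness on the Banach space `vanishingOutside K`: translation boundedness is
pointwise boundedness of the family of translates of `μ`, and the bound obtained is uniform in `t`.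
-/
theorem TranslationBounded.exists_bound {μ : RadonMeasure G} (hμ : μ.TranslationBounded)
    {K : Set G} (hK : IsCompact K) : ∃ C : ℝ, ∀ (t : G) (φ : C_c(G, ℂ)), tsupport φ ⊆ K →
      ∀ M : ℝ, (∀ s, ‖φ s‖ ≤ M) → ‖(t +ᵥ μ).toLinearMap φ‖ ≤ C * M := by
  have hcomplete : CompleteSpace (vanishingOutside K) :=
    (isClosed_vanishingOutside K).completeSpace_coe
  obtain ⟨C, hC⟩ := banach_steinhaus (g := fun t : G => (t +ᵥ μ).restrictCLM hK) fun f => by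
    obtain ⟨M, hM⟩ := hμ (reflectFun 0 (ofVanishingOutside hK f))
    refine ⟨M, fun t => ?_⟩
    have h : (t +ᵥ μ).restrictCLM hK f = μ.conv (reflectFun 0 (ofVanishingOutside hK f)) t :=
      vadd_eq_conv μ t _
    rw [h]
    exact hM t
  refine ⟨C, fun t φ hφ M hM => ?_⟩
  have hM0 : 0 ≤ M := (norm_nonneg _).trans (hM 0)
  let f : vanishingOutside K :=
    ⟨.ofNormedAddCommGroup φ φ.continuous M hM, fun s hs =>
      image_eq_zero_of_notMem_tsupport fun h => hs (hφ h)⟩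
  have hf : ‖f‖ ≤ M := norm_ofNormedAddCommGroup_le _ hM0 hM
  calc ‖(t +ᵥ μ).toLinearMap φ‖ = ‖(t +ᵥ μ).restrictCLM hK f‖ := rfl
    _ ≤ ‖(t +ᵥ μ).restrictCLM hK‖ * ‖f‖ := ContinuousLinearMap.le_opNorm _ _
    _ ≤ C * M := mul_le_mul (hC t) hf (norm_nonneg _) ((norm_nonneg _).trans (hC t))

theorem TranslationBounded.isCompact_hull {μ : RadonMeasure G} (hμ : μ.TranslationBounded) :
    IsCompact μ.hull := by
  classical
  choose C hC using fun (K : Set G) (hK : IsCompact K) => hμ.exists_bound hK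
  have h := isCompact_of_bounds (G := G) fun K => if hK : IsCompact K then C K hK else 0
  refine h.of_isClosed_subset isClosed_closure (closure_minimal ?_ h.isClosed)
  rintro _ ⟨t, rfl⟩ K hK φ hφ M hM
  rw [dif_pos hK]
  exact hC K hK t φ hφ M hM

/-- For `t` in a compact neighbourhood `N` of `t₀`, the translates of `φ` are supported in the
compact set `N + tsupport φ`. There they converge uniformly as `t → t₀`, and `μ` is bounded on
functions supported there. -/
theorem continuous_vadd_right [LocallyCompactSpace G] (μ : RadonMeasure G) :
    Continuous fun t : G => t +ᵥ μ := by
  refine isEmbedding_eval.continuous_iff.mpr (continuous_pi fun φ => ?_)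
  rw [continuous_iff_continuousAt]
  intro t₀
  obtain ⟨N, hN, hNt⟩ := exists_compact_mem_nhds t₀
  have hK : IsCompact (N + tsupport φ) := hN.add φ.hasCompactSupport
  obtain ⟨C, hC⟩ := μ.bounded_of_isCompact _ hK
  let Φ : C(G, C(G, ℂ)) := ContinuousMap.curry ⟨fun p : G × G => φ (p.2 - p.1), by fun_prop⟩
  have hΦ := ContinuousMap.tendsto_iff_forall_isCompact_tendstoUniformlyOn.mp
    (Φ.continuous.tendsto t₀) _ hK
  rw [Metric.tendstoUniformlyOn_iff] at hΦ
  have hzero : ∀ t ∈ N, ∀ s ∉ N + tsupport φ, φ (s - t) = 0 := fun t ht s hs =>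
    image_eq_zero_of_notMem_tsupport fun h => hs ⟨t, ht, s - t, h, add_sub_cancel t s⟩
  rw [ContinuousAt, Metric.tendsto_nhds]
  intro ε hε
  filter_upwards [hΦ (ε / (|C| + 1)) (by positivity), hNt] with t ht htN
  have h1 : ∀ s, ‖(translateFun t φ - translateFun t₀ φ) s‖ ≤ ε / (|C| + 1) := by
    intro s
    change ‖φ (s - t) - φ (s - t₀)‖ ≤ _
    by_cases hs : s ∈ N + tsupport φ
    · rw [← dist_eq_norm, dist_comm]
      exact (ht s hs).le
    · rw [hzero t htN s hs, hzero t₀ (mem_of_mem_nhds hNt) s hs, sub_zero, norm_zero]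
      positivity
  have h2 := hC (translateFun t φ - translateFun t₀ φ)
    (tsupport_subset_of_vanishing hK fun s hs => by
      change φ (s - t) - φ (s - t₀) = 0
      rw [hzero t htN s hs, hzero t₀ (mem_of_mem_nhds hNt) s hs, sub_zero]) _ h1
  rw [map_sub] at h2
  rw [dist_eq_norm]
  refine h2.trans_lt ?_
  calc C * (ε / (|C| + 1)) ≤ |C| * (ε / (|C| + 1)) := by
        gcongr
        exact le_abs_self C
    _ < ε := by
        rw [mul_div_assoc', div_lt_iff₀ (by positivity)]
        nlinarith [abs_nonneg C]

theorem continuous_vadd_toHull [LocallyCompactSpace G] (μ : RadonMeasure G) :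
    Continuous fun t : G => t +ᵥ μ.toHull :=
  (continuous_vadd_right μ).subtype_mk _

instance (μ : RadonMeasure G) : ContinuousConstVAdd G μ.hull where
  continuous_const_vadd t :=
    ((continuous_const_vadd t).comp continuous_subtype_val).subtype_mk _

/-- Evaluation at a test function as a continuous function on the hull. -/
def hullEval (μ : RadonMeasure G) (φ : C_c(G, ℂ)) : C(μ.hull, ℂ) :=
  ⟨fun ν => ν.1.toLinearMap φ, (continuous_eval φ).comp continuous_subtype_val⟩

variable [LocallyCompactSpace G] [MeasurableSpace G] [BorelSpace G] {ν : ℕ → Measure G}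
  [∀ n, IsProbabilityMeasure (ν n)]

theorem orbitBCF_hullEval (μ : RadonMeasure G) [CompactSpace μ.hull] (φ : C_c(G, ℂ)) :
    ⇑(orbitBCF μ.continuous_vadd_toHull (μ.hullEval (reflectFun 0 φ))) = μ.conv φ :=
  funext fun t => vadd_reflectFun_zero μ t φ

theorem approximable_of_hullEval (μ : RadonMeasure G) [CompactSpace μ.hull]
    (H : ∀ φ, Approximable ν (orbitBCF μ.continuous_vadd_toHull (μ.hullEval φ)))
    (f : C(μ.hull, ℂ)) : Approximable ν (orbitBCF μ.continuous_vadd_toHull f) := by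
  refine approximable_of_separatesPoints _ (T := Set.range μ.hullEval) ?_ ?_ f
  · rintro _ ⟨φ, rfl⟩
    exact H φ
  · intro ν₁ ν₂ hne
    obtain ⟨φ, hφ⟩ : ∃ φ, ν₁.1.toLinearMap φ ≠ ν₂.1.toLinearMap φ := by
      by_contra! h
      exact hne (Subtype.ext (RadonMeasure.ext h))
    exact ⟨_, ⟨φ, rfl⟩, hφ⟩

theorem isBesicovitchAP_iff_approximable {θ : Measure G} [θ.IsAddHaarMeasure] {A : ℕ → Set G}
    (hA : IsVanHove θ A) (μ : RadonMeasure G) [CompactSpace μ.hull] :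
    μ.IsBesicovitchAP θ A ↔ ∀ f : C(μ.hull, ℂ),
      Approximable (fun n => ProbabilityTheory.cond θ (A n))
        (orbitBCF μ.continuous_vadd_toHull f) := by
  have := hA.isProbabilityMeasure_cond
  constructor
  · intro H
    refine approximable_of_hullEval μ fun φ => ?_
    rw [← hA.isBesicovitchAP_iff]
    have h : reflectFun 0 (reflectFun 0 φ) = φ := by
      ext s
      change φ (0 - (0 - s)) = φ s
      congr 1
      abel
    have h2 := orbitBCF_hullEval μ (reflectFun 0 φ)
    rw [h] at h2
    rw [h2]
    exact H _
  · intro H φ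
    rw [← orbitBCF_hullEval, hA.isBesicovitchAP_iff]
    exact H _

end RadonMeasure

end WienerWintner

end

theorem corollary7p1 {G : Type*} [AddCommGroup G] [TopologicalSpace G] [IsTopologicalAddGroup G]
    [T2Space G] [LocallyCompactSpace G] [SigmaCompactSpace G]
    [MeasurableSpace G] [BorelSpace G] (θ : Measure G) [θ.IsAddHaarMeasure]
    (A : ℕ → Set G) (hA : WienerWintner.IsVanHove θ A)
    (μ : WienerWintner.RadonMeasure G) (hμ : μ.TranslationBounded) :
    μ.IsBesicovitchAP θ A ↔
      ∃ m : Measure μ.hull, IsProbabilityMeasure m ∧ m.Regular ∧ ErgodicVAdd G μ.hull m ∧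
        WienerWintner.HasPurePointSpectrum G m ∧
        WienerWintner.IsWienerWintnerPoint θ A m μ.toHull := by
  open WienerWintner in
  have hcompact : CompactSpace μ.hull := isCompact_iff_compactSpace.mp hμ.isCompact_hull
  have hprob := hA.isProbabilityMeasure_cond
  have hν := hA.asymptoticallyInvariant
  have hx := μ.continuous_vadd_toHull
  have havg : ∀ (f : C(μ.hull, ℂ)) (χ : Dual G) (n : ℕ),
      ((θ.real (A n) : ℂ))⁻¹ *
        ∫ t in A n, f (t +ᵥ μ.toHull) * (starRingEnd ℂ) (charValue χ t) ∂θ =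
      ∫ t, (orbitBCF hx f * star (charBCF χ)) t ∂(ProbabilityTheory.cond θ (A n)) :=
    fun f χ n => (integral_cond_eq (A n) _).symm
  -- From here on only the compact system `μ.hull` with the point `μ.toHull` matters.
  rw [RadonMeasure.isBesicovitchAP_iff_approximable hA]
  constructor
  · intro H
    obtain ⟨m, hm, hreg, hp, e, hk, h1, hspan, hlim⟩ :=
      exists_eigenfunctions_of_approximable hx hν H
    refine ⟨m, hm, hreg, ergodicVAdd_of_span hp hk h1 hspan,
      hasPurePointSpectrum_of_span hp hk hspan, {f | f ≠ 0 ∧ f ∈ Set.range e}, ?_,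
      fun χ hχ => eigenbasis_of_span hp hk h1 hspan rfl hχ, ?_⟩
    · rintro _ ⟨h0, χ, rfl⟩
      exact ⟨χ, (isEigenfunction_iff hp).mpr ⟨h0, hk χ⟩⟩
    · rintro f _ ⟨h0, ψ, rfl⟩ χ hχ
      have hψ : IsEigenfunction m ψ (e ψ) := (isEigenfunction_iff hp).mpr ⟨h0, hk ψ⟩
      obtain rfl := hψ.eq_of_isEigenfunction hp hχ
      simp only [havg, ← inner_toL2_right]
      exact hlim ψ f
  · rintro ⟨m, hm, hreg, herg, hpp, B, -, hB, hlim⟩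
    have hp : ∀ t : G, MeasurePreserving (fun x : μ.hull => t +ᵥ x) m m := fun t =>
      measurePreserving_vadd t m
    refine approximable_of_tendsto_inner hx hν hp hpp hB fun f e he χ hχ => ?_
    have h := hlim f e he χ hχ
    simp only [havg, ← inner_toL2_right] at h
    exact h
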